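/- **Setting.** For each sample size $n$ let $p=p_n$, let $\Sigma^*$ be a positive definite $p\times p$ correlation matrix, $\Theta^*=(\theta^*_{ij})=(\Sigma^*)^{-1}$, and let $x_1,\dots,x_n$ be i.i.d. from a nonparanormal law with parameter $\Sigma^*$: there are univariate monotone increasing transformations $f_j$, each defined on a set that carries the $j$-th marginal, such that $(f_1(X_1),\dots,f_p(X_p))\sim N_p(0,\Sigma^*)$. Let $\hat r_{ij}$ be Spearman's rank correlation of variables $i,j$ (Pearson's correlation of the ranks) and $\hat R^s=(2\sin(\frac{\pi}{6}\hat r_{ij}))_{i,j}$. For a matrix $A$ and $k\le p$ let $(k)=\{1,\dots,p\}\setminus\{k\}$, $A_{(k)}=A_{(k),(k)}$ and $a_{(k)}=A_{(k),k}$. Put $S_k=\{j\ne k:\theta^*_{kj}\neq0\}$, $S_k^c=(k)\setminus S_k$, $d=\max_k|S_k|$, and $\beta^*_{S_k}=(\Sigma^*_{S_kS_k})^{-1}\sigma^*_{S_k}$, where $\sigma^*_{S_k}=\Sigma^*_{S_k,k}$. With $\|A\|_{\ell_1}=\max_j\sum_i|a_{ij}|$ and $\|A\|_{\ell_\infty}=\max_i\sum_j|a_{ij}|$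 let $$b_n=\min_k\theta^*_{kk},\quad B_n=\lambda_{\max}(\Theta^*),\quad M_n=\|\Theta^*\|_{\ell_1},$$ $$\psi_k=\min_{j\in S_k}|\beta^*_{jk}|,\quad G_k=\|(\Sigma^*_{S_kS_k})^{-1}\|_{\ell_\infty},\quad H_k=\|\Sigma^*_{S_k^cS_k}(\Sigma^*_{S_kS_k})^{-1}\|_{\ell_\infty}.$$ **Estimators.** Given tuning parameters $\lambda_d=\lambda_{d,k}$ and $\lambda_{ad}=\lambda_{ad,k}$ (nonrandom; they may or may not depend on $k$), let $\hat\beta_k^{s.nd}$ be an optimal solution of $$\min_{\beta\in\mathbb R^{p-1}}\|\beta\|_{\ell_1}\quad\text{subject to}\quad \|\hat R^s_{(k)}\beta-\hat r^s_{(k)}\|_{\ell_\infty}\le\lambda_d ,$$ let $w_k=(|\hat\beta_k^{s.nd}|+\frac1n)^{-1}$ entrywise, and let $\hat\beta_k^{s.nad}$ be an optimal solution of the adaptive problem $$\min_{\beta\in\mathbb R^{p-1}}\|w_k\circ\beta\|_{\ell_1}\quad\text{subject to}\quad |\hat R^s_{(k)}\beta-\hat r^s_{(k)}|\le\lambda_{ad}w_k\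 \text{ entrywise.}$$ **Statement.** There is an absolute constant $A>0$ such that the following holds for all constants $b,B,M,\psi,G,H>0$. Suppose that for all $n$ the graph has an edge ($d\ge1$), $b_n\ge b$, $B_n\le B$, $M_n\le M$, and for all $k\le p$: $G_k\le G$, $H_k\le H$, and $\psi_k\ge\psi$ if $S_k\ne\emptyset$. Suppose, as $n\to\infty$ and uniformly in $k$ (conditions on $\lambda_{\min}(\Sigma^*_{S_kS_k})$ being imposed for $S_k\neq\emptyset$ only), that $$n\gg d^4\log p,\qquad \lambda_{\min}(\Sigma^*_{S_kS_k})\gg d^2\sqrt{\log p/n},$$ that $\lambda_d$ is of exact order $\sqrt{\log p/n}$ with a large enough constant, that is, $A\frac Mb\sqrt{\log p/n}\le\lambda_d=O(\sqrt{\log p/n})$ for all large $n$, and that $$\tfrac1d\gg\lambda_d,\qquad \min\{\tfrac1d\lambda_{\min}(\Sigma^*_{S_kS_k}),\tfrac1d\}\gg\lambda_{ad}\gg d\lambda_d .$$ Then with probability tending to $1$ all of the following hold: for every $k$ the solution $\hat\beta_k^{s.nd}$ exists and, whichever solutions $\hat\beta_k^{s.nd}$ are used in the weights, 1. for every $k$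 the adaptive problem has an optimal solution $\hat\beta_k^{s.nad}$, and only one provided that no coordinate of $(\hat R^s_{S_kS_k})^{-1}(w_{S_k}\circ\operatorname{sign}(\beta^*_{S_k}))$ vanishes; 2. for every $k$, every optimal solution satisfies $\operatorname{sign}(\hat\beta^{s.nad}_{S_k})=\operatorname{sign}(\beta^*_{S_k})$ and $\hat\beta^{s.nad}_{S_k^c}=0$, and its support is exactly $S_k$; 3. consequently the graph estimated from the supports of $\hat\beta_1^{s.nad},\dots,\hat\beta_p^{s.nad}$, by union or by intersection, is the true graph $\{\{i,j\}:i\ne j,\ \theta^*_{ij}\ne0\}$. -/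

import Mathlib

open MeasureTheory ProbabilityTheory Filter Topology Asymptotics
open scoped Matrix

noncomputable section

namespace RankGraph

/-! ### The nonparanormal model -/

/-- `μ` is a nonparanormal law with parameter `Sig`: there are univariate monotone increasing
transformations `f j`, each defined on a set `I j` that carries the `j`-th marginal, such that
`(f 1 (X 1), …, f p (X p))` is `N(0, Sig)` when `X` has law `μ`.
(The sets `I j` are there so that marginals with bounded support are allowed: there the
transformation has infinite limits at the end points of the support.) -/
def IsNonparanormal {p : ℕ} (μ : Measure (Fin p → ℝ)) (Sig : Matrix (Fin p) (Fin p) ℝ) : Prop :=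
  ∃ (f : Fin p → ℝ → ℝ) (I : Fin p → Set ℝ),
    (∀ j, MonotoneOn (f j) (I j)) ∧ (∀ j, ∀ᵐ x ∂μ, x j ∈ I j) ∧
    μ.map (fun x => WithLp.toLp 2 (fun j => f j (x j))) = multivariateGaussian 0 Sig

/-! ### The rank-based estimate of the covariance matrix -/

/-- The rank of `v l` among `v 1, …, v n`. -/
def sampleRank {n : ℕ} (v : Fin n → ℝ) (l : Fin n) : ℝ :=
  ((Finset.univ.filter fun m => v m ≤ v l).card : ℝ)

/-- The sample mean. -/
def sampleMean {n : ℕ} (v : Fin n → ℝ) : ℝ := (∑ l, v l) / n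

/-- Pearson's sample correlation. -/
def pearson {n : ℕ} (u v : Fin n → ℝ) : ℝ :=
  (∑ l, (u l - sampleMean u) * (v l - sampleMean v)) /
    (√(∑ l, (u l - sampleMean u) ^ 2) * √(∑ l, (v l - sampleMean v) ^ 2))

/-- Spearman's rank correlation. -/
def spearman {n : ℕ} (u v : Fin n → ℝ) : ℝ := pearson (sampleRank u) (sampleRank v)

/-- The matrix of adjusted Spearman correlations of the data `x`, with rows `x l` the
observations. -/
def rankMatrix {n p : ℕ} (x : Fin n → Fin p → ℝ) : Matrix (Fin p) (Fin p) ℝ :=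
  Matrix.of fun i j =>
    2 * Real.sin (Real.pi / 6 * spearman (fun l => x l i) (fun l => x l j))

/-! ### Matrix quantities -/

/-- The index set `(k) = {1, …, p} \ {k}`. -/
abbrev Off {p : ℕ} (k : Fin p) : Type := {j : Fin p // j ≠ k}

/-- `A_(k)`: the matrix `A` without its `k`-th row and column. -/
def offMat {p : ℕ} (A : Matrix (Fin p) (Fin p) ℝ) (k : Fin p) : Matrix (Off k) (Off k) ℝ :=
  A.submatrix Subtype.val Subtype.val

/-- `a_(k)`: the `k`-th column of `A` without its `k`-th entry. -/
def offVec {p : ℕ} (A : Matrix (Fin p) (Fin p) ℝ) (k : Fin p) : Off k → ℝ :=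
  fun j => A j.1 k

/-- The block `A_{ST}` of a matrix. -/
def block {ι : Type*} (A : Matrix ι ι ℝ) (S T : Finset ι) : Matrix S T ℝ :=
  A.submatrix Subtype.val Subtype.val

/-- The matrix `ℓ₁` norm, `max_j ∑_i |a_ij|`. -/
def normL1 {ι κ : Type*} [Fintype ι] (A : Matrix ι κ ℝ) : ℝ := ⨆ j, ∑ i, |A i j|

/-- The matrix `ℓ_∞` norm, `max_i ∑_j |a_ij|`. -/
def normLinf {ι κ : Type*} [Fintype κ] (A : Matrix ι κ ℝ) : ℝ := ⨆ i, ∑ j, |A i j|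

/-- The largest eigenvalue (of a symmetric matrix of positive size). -/
def maxEig {ι : Type*} [Fintype ι] [DecidableEq ι] (A : Matrix ι ι ℝ) : ℝ := sSup (spectrum ℝ A)

/-- The smallest eigenvalue (of a symmetric matrix of positive size). -/
def minEig {ι : Type*} [Fintype ι] [DecidableEq ι] (A : Matrix ι ι ℝ) : ℝ := sInf (spectrum ℝ A)

open Classical in
/-- The active set `S_k = {j ≠ k : θ_kj ≠ 0}`, where `Θ = Sig⁻¹`. -/
def activeSet {p : ℕ} (Sig : Matrix (Fin p) (Fin p) ℝ) (k : Fin p) : Finset (Off k) :=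
  Finset.univ.filter fun j => Sig⁻¹ k j.1 ≠ 0

/-- The maximal degree `d = max_k |S_k|`. -/
def maxDegree {p : ℕ} (Sig : Matrix (Fin p) (Fin p) ℝ) : ℕ :=
  Finset.univ.sup fun k => (activeSet Sig k).card

/-- `Σ_{S_k S_k}`. -/
def sigSS {p : ℕ} (Sig : Matrix (Fin p) (Fin p) ℝ) (k : Fin p) :
    Matrix (activeSet Sig k) (activeSet Sig k) ℝ :=
  block (offMat Sig k) (activeSet Sig k) (activeSet Sig k)

/-- `Σ_{S_k^c S_k}`, where the complement is taken in `(k)`. -/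
def sigScS {p : ℕ} (Sig : Matrix (Fin p) (Fin p) ℝ) (k : Fin p) :
    Matrix ((activeSet Sig k)ᶜ : Finset (Off k)) (activeSet Sig k) ℝ :=
  block (offMat Sig k) (activeSet Sig k)ᶜ (activeSet Sig k)

/-- `β*_{S_k} = (Σ_{S_k S_k})⁻¹ σ_{S_k}`. -/
def betaActive {p : ℕ} (Sig : Matrix (Fin p) (Fin p) ℝ) (k : Fin p) : activeSet Sig k → ℝ :=
  (sigSS Sig k)⁻¹ *ᵥ fun j => offVec Sig k j.1

/-- `b = min_k θ_kk`. -/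
def minDiag {p : ℕ} (Sig : Matrix (Fin p) (Fin p) ℝ) : ℝ := ⨅ k, Sig⁻¹ k k

/-- `ψ_k = min_{j ∈ S_k} |β*_{jk}|`. -/
def psi {p : ℕ} (Sig : Matrix (Fin p) (Fin p) ℝ) (k : Fin p) : ℝ := ⨅ j, |betaActive Sig k j|

/-- `G_k = ‖(Σ_{S_k S_k})⁻¹‖_{ℓ_∞}`. -/
def gK {p : ℕ} (Sig : Matrix (Fin p) (Fin p) ℝ) (k : Fin p) : ℝ := normLinf (sigSS Sig k)⁻¹

/-- `H_k = ‖Σ_{S_k^c S_k} (Σ_{S_k S_k})⁻¹‖_{ℓ_∞}`. -/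
def hK {p : ℕ} (Sig : Matrix (Fin p) (Fin p) ℝ) (k : Fin p) : ℝ :=
  normLinf (sigScS Sig k * (sigSS Sig k)⁻¹)

/-! ### The (adaptive) Dantzig selector -/

/-- `β` is an optimal solution of: minimize `‖w ∘ β‖_{ℓ₁}` subject to
`|R_(k) β - r_(k)| ≤ lam • w` entrywise. -/
def IsAdaptiveDantzig {p : ℕ} (R : Matrix (Fin p) (Fin p) ℝ) (k : Fin p) (lam : ℝ)
    (w β : Off k → ℝ) : Prop :=
  (∀ j, |(offMat R k *ᵥ β - offVec R k) j| ≤ lam * w j) ∧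
  ∀ β' : Off k → ℝ, (∀ j, |(offMat R k *ᵥ β' - offVec R k) j| ≤ lam * w j) →
    ∑ j, |w j * β j| ≤ ∑ j, |w j * β' j|

/-- `β` is an optimal solution of the Dantzig selector: minimize `‖β‖_{ℓ₁}` subject to
`‖R_(k) β - r_(k)‖_{ℓ_∞} ≤ lam`. -/
def IsDantzig {p : ℕ} (R : Matrix (Fin p) (Fin p) ℝ) (k : Fin p) (lam : ℝ)
    (β : Off k → ℝ) : Prop :=
  (∀ j, |(offMat R k *ᵥ β - offVec R k) j| ≤ lam) ∧
  ∀ β' : Off k → ℝ, (∀ j, |(offMat R k *ᵥ β' - offVec R k) j| ≤ lam) →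
    ∑ j, |β j| ≤ ∑ j, |β' j|

/-- The adaptive weights `(|β| + 1/n)⁻¹`. -/
def weights (n : ℕ) {ι : Type*} (β : ι → ℝ) : ι → ℝ := fun j => (|β j| + 1 / (n : ℝ))⁻¹

/-- Nondegeneracy of the `k`-th adaptive problem: no coordinate of
`(R_{S_k S_k})⁻¹ (w_{S_k} ∘ sign β*_{S_k})` vanishes. -/
def Nondegenerate {p : ℕ} (Sig R : Matrix (Fin p) (Fin p) ℝ) (k : Fin p) (w : Off k → ℝ) : Prop :=
  ∀ j, ((block (offMat R k) (activeSet Sig k) (activeSet Sig k))⁻¹ *ᵥ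
    fun i : activeSet Sig k => w i.1 * Real.sign (betaActive Sig k i)) j ≠ 0

/-! ### Graphs -/

/-- The graph of the model: distinct `i`, `j` are joined when `θ_ij ≠ 0` (`Θ = Sig⁻¹` is
symmetric). -/
def trueGraph {p : ℕ} (Sig : Matrix (Fin p) (Fin p) ℝ) : SimpleGraph (Fin p) :=
  SimpleGraph.fromRel fun i j => Sig⁻¹ i j ≠ 0

/-- `j` belongs to the estimated neighborhood of `i`. -/
def InNbhd {p : ℕ} (β : ∀ k : Fin p, Off k → ℝ) (i j : Fin p) : Prop :=
  ∃ h : j ≠ i, β i ⟨j, h⟩ ≠ 0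

/-- Aggregation of the estimated neighborhoods by union. -/
def unionGraph {p : ℕ} (β : ∀ k : Fin p, Off k → ℝ) : SimpleGraph (Fin p) where
  Adj i j := InNbhd β i j ∨ InNbhd β j i
  symm := ⟨fun _ _ h => h.symm⟩
  loopless := ⟨fun _ h => h.elim (fun h => h.1 rfl) (fun h => h.1 rfl)⟩

/-- Aggregation of the estimated neighborhoods by intersection. -/
def interGraph {p : ℕ} (β : ∀ k : Fin p, Off k → ℝ) : SimpleGraph (Fin p) where
  Adj i j := InNbhd β i j ∧ InNbhd β j i
  symm := ⟨fun _ _ h => h.symm⟩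
  loopless := ⟨fun _ h => h.1.1 rfl⟩

/-! ### The event and the asymptotic relation -/

/-- The event of the theorem, for sample size `n`, estimated matrix `R` and tuning parameters
`lamD k`, `lamAd k`. -/
def Recovers {p : ℕ} (n : ℕ) (Sig R : Matrix (Fin p) (Fin p) ℝ) (lamD lamAd : Fin p → ℝ) : Prop :=
  -- the Dantzig selectors that define the weights exist
  (∀ k, ∃ β, IsDantzig R k (lamD k) β) ∧
  -- and whichever of their optimal solutions are used in the weights:
  ∀ βnd : ∀ k : Fin p, Off k → ℝ, (∀ k, IsDantzig R k (lamD k) (βnd k)) →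
    -- the adaptive Dantzig selectors exist
    (∀ k, ∃ β, IsAdaptiveDantzig R k (lamAd k) (weights n (βnd k)) β) ∧
    -- they are unique, up to ties in the dual problem
    (∀ k, Nondegenerate Sig R k (weights n (βnd k)) → ∀ β β',
      IsAdaptiveDantzig R k (lamAd k) (weights n (βnd k)) β →
      IsAdaptiveDantzig R k (lamAd k) (weights n (βnd k)) β' → β = β') ∧
    -- and any choice of them recovers the signs, the supports and the graph
    ∀ βad : ∀ k : Fin p, Off k → ℝ,
      (∀ k, IsAdaptiveDantzig R k (lamAd k) (weights n (βnd k)) (βad k)) →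
      (∀ k, ∀ j : activeSet Sig k, Real.sign (βad k j.1) = Real.sign (betaActive Sig k j)) ∧
      (∀ k j, j ∉ activeSet Sig k → βad k j = 0) ∧
      (∀ k j, βad k j ≠ 0 ↔ j ∈ activeSet Sig k) ∧
      unionGraph βad = trueGraph Sig ∧ interGraph βad = trueGraph Sig

/-- `a ≪ b` as `n → ∞`, uniformly in the further index: `a = o(b)` with nonnegative `b`. -/
def MuchLess {ι : ℕ → Type*} (a b : ∀ n, ι n → ℝ) : Prop :=
  ∀ ε : ℝ, 0 < ε → ∀ᶠ n in atTop, ∀ i, |a n i| ≤ ε * b n i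

end RankGraph

end

open RankGraph

/-! The proof separates a probabilistic estimate of `rankMatrix - Sig`, uniform over the entries,
from a deterministic recovery statement.

Probability. Ranks are almost surely unchanged by the monotone transformations, so the sample may be
taken Gaussian. Without ties Spearman's correlation is an affine function of `rankProduct`, a sum of
indicators over triples of observations. For three distinct observations the indicator has mean `θ =
1/4 + arcsin(σ/2)/(2π)` by Sheppard's formula, because two differences that share one observation
have correlation `σ/2`; and `2 sin(π/6 (12θ - 3)) = σ`. The coincident triples cause a bias of order
`1/n`. Replacing one observation changes the sum by at most `3n²`, so the bounded difference
inequality and a union bound give entrywise error at most `deviationConst s * L`, where `L = √(log p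
/ n)`, outside an event of probability at most `2 p^(-s)`.

Dantzig step. The population coefficients `betaStar` solve the population equations and have `ℓ₁`
norm below `M/b`. If `λ_d` dominates the noise, `betaStar` is feasible; comparison of `ℓ₁` norms and
the stability of the population system (`abs_le_of_offMat_mulVec_le`) bound the sup-norm error by a
multiple of `λ_d`, hence of `L`.

Adaptive step. The weights are then at most `2/ψ` on the active set and at least of order `1/L` off
it. `weightedDantzig_recovery` writes down a primal point and a dual certificate, both supported on
the active set. Strict dual feasibility off the active set excludes false positives for every
optimal solution, and stability of the estimated block gives the signs.

The dimension need not tend to infinity, so `2/p` need not be small. Fix a tolerated failure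
probability `η`. When `2/p ≤ η` the base level `s = 1` suffices, and the lower bound on `λ_d` is
tuned to it. Otherwise `p ≤ 2/η` is bounded; a larger `s` makes the failure probability small, `λ_d`
may no longer dominate the noise, but `L` is so small that the whole matrix `R_(k)` is invertible
with a stable inverse. This replaces feasibility of `betaStar` (`dantzig_error_of_dim_mul_le`). -/

/-! ### Orthant probabilities of Gaussian pairs -/

/-- The radial factor of the planar standard Gaussian measure in polar coordinates. -/
noncomputable def gaussianRadialMass : ENNReal :=
  ∫⁻ r in Set.Ioi (0 : ℝ), ENNReal.ofReal r *
    ENNReal.ofReal ((2 * Real.pi)⁻¹ * Real.exp (-(r ^ 2) / 2))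

/-- The planar density depends on the radius alone, so the measure of a cone factors in polar
coordinates. The origin and the negative half-axis are null and need no condition. -/
theorem stdGaussian_prod_apply_of_polar {A : Set ℝ} (hA : MeasurableSet A) {S : Set (ℝ × ℝ)}
    (hS : MeasurableSet S)
    (h : ∀ r > 0, ∀ θ ∈ Set.Ioo (-Real.pi) Real.pi,
      ((r * Real.cos θ, r * Real.sin θ) ∈ S ↔ θ ∈ A)) :
    ((gaussianReal 0 1).prod (gaussianReal 0 1)) S =
      gaussianRadialMass * volume (A ∩ Set.Ioo (-Real.pi) Real.pi) := by
  have hg : gaussianReal 0 1 = volume.withDensity (gaussianPDF 0 1) :=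
    gaussianReal_of_var_ne_zero 0 one_ne_zero
  rw [hg, prod_withDensity (by fun_prop) (by fun_prop), withDensity_apply _ hS,
    ← lintegral_indicator hS, ← Measure.volume_eq_prod, ← lintegral_comp_polarCoord_symm,
    polarCoord_target, Measure.volume_eq_prod, ← Measure.prod_restrict]
  have key : ∀ z ∈ Set.Ioi (0 : ℝ) ×ˢ Set.Ioo (-Real.pi) Real.pi,
      ENNReal.ofReal z.1 • S.indicator
        (fun z : ℝ × ℝ => gaussianPDF 0 1 z.1 * gaussianPDF 0 1 z.2) (polarCoord.symm z) =
      (ENNReal.ofReal z.1 * ENNReal.ofReal ((2 * Real.pi)⁻¹ * Real.exp (-(z.1 ^ 2) / 2))) *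
        A.indicator 1 z.2 := by
    rintro ⟨r, θ⟩ ⟨hr, hθ⟩
    have hiff := h r hr θ hθ
    have hpdf : gaussianPDF 0 1 (r * Real.cos θ) * gaussianPDF 0 1 (r * Real.sin θ) =
        ENNReal.ofReal ((2 * Real.pi)⁻¹ * Real.exp (-(r ^ 2) / 2)) := by
      rw [gaussianPDF, gaussianPDF, ← ENNReal.ofReal_mul (gaussianPDFReal_nonneg _ _ _)]
      congr 1
      simp only [gaussianPDFReal, sub_zero, NNReal.coe_one, mul_one]
      rw [mul_mul_mul_comm, ← Real.exp_add, ← mul_inv, Real.mul_self_sqrt (by positivity)]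
      congr 2
      have := Real.sin_sq_add_cos_sq θ
      linear_combination (-(r ^ 2) / 2) * this
    by_cases hm : θ ∈ A
    · have hm' := hiff.2 hm
      simp [polarCoord_symm_apply, hm, hm', hpdf]
    · have hm' : (r * Real.cos θ, r * Real.sin θ) ∉ S := fun h' => hm (hiff.1 h')
      simp [polarCoord_symm_apply, hm, hm']
  rw [Measure.prod_restrict, setLIntegral_congr_fun (measurableSet_Ioi.prod measurableSet_Ioo) key,
    ← Measure.prod_restrict, lintegral_prod_mul (f := fun r => ENNReal.ofReal r *
      ENNReal.ofReal ((2 * Real.pi)⁻¹ * Real.exp (-(r ^ 2) / 2))) (by fun_prop)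
      ((measurable_one.indicator hA).aemeasurable),
    lintegral_indicator_one hA, Measure.restrict_apply hA]
  rfl

/-- Taking the whole plane as the cone gives the radial mass by normalization, with no integral to
compute. -/
theorem gaussianRadialMass_eq : gaussianRadialMass = ENNReal.ofReal (2 * Real.pi)⁻¹ := by
  have h := stdGaussian_prod_apply_of_polar (A := Set.univ) (S := Set.univ)
    MeasurableSet.univ MeasurableSet.univ (by simp)
  rw [measure_univ, Set.univ_inter, Real.volume_Ioo] at h
  have hpi := Real.pi_pos
  rw [ENNReal.ofReal_inv_of_pos (by positivity)]
  refine ENNReal.eq_inv_of_mul_eq_one_left ?_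
  rw [h]; congr 2; ring

/-- The second linear form is `r cos(θ - φ)`, so the set is the sector `φ - π/2 < θ < π/2` of angle
`π - φ`. -/
theorem stdGaussian_prod_sector {φ : ℝ} (h0 : 0 < φ) (h1 : φ < Real.pi) :
    ((gaussianReal 0 1).prod (gaussianReal 0 1)).real
      {z | 0 < z.1 ∧ 0 < Real.cos φ * z.1 + Real.sin φ * z.2} =
    (Real.pi - φ) / (2 * Real.pi) := by
  have hpi := Real.pi_pos
  have hS : MeasurableSet {z : ℝ × ℝ | 0 < z.1 ∧ 0 < Real.cos φ * z.1 + Real.sin φ * z.2} :=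
    (measurableSet_lt measurable_const measurable_fst).inter (measurableSet_lt measurable_const
      ((measurable_fst.const_mul _).add (measurable_snd.const_mul _)))
  rw [measureReal_def, stdGaussian_prod_apply_of_polar
    (A := Set.Ioo (φ - Real.pi / 2) (Real.pi / 2)) measurableSet_Ioo hS]
  · have : Set.Ioo (φ - Real.pi / 2) (Real.pi / 2) ∩ Set.Ioo (-Real.pi) Real.pi =
        Set.Ioo (φ - Real.pi / 2) (Real.pi / 2) :=
      Set.inter_eq_left.2 (Set.Ioo_subset_Ioo (by linarith) (by linarith))
    rw [this, Real.volume_Ioo, gaussianRadialMass_eq, ← ENNReal.ofReal_mul (by positivity),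
      ENNReal.toReal_ofReal]
    · ring
    · exact mul_nonneg (by positivity) (by linarith)
  · intro r hr θ hθ
    have e : Real.cos φ * (r * Real.cos θ) + Real.sin φ * (r * Real.sin θ) =
        r * Real.cos (θ - φ) := by rw [Real.cos_sub]; ring
    simp only [Set.mem_ofPred_eq, e, mul_pos_iff_of_pos_left hr, Set.mem_Ioo]
    obtain ⟨hθ1, hθ2⟩ := hθ
    constructor
    · rintro ⟨hc, hc'⟩
      have ha : θ < Real.pi / 2 := by
        by_contra! hcon
        exact absurd hc (not_lt.2
          (Real.cos_nonpos_of_pi_div_two_le_of_le hcon (by linarith)))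
      have hb : -(Real.pi / 2) < θ := by
        by_contra! hcon
        rw [← Real.cos_neg] at hc
        exact absurd hc (not_lt.2
          (Real.cos_nonpos_of_pi_div_two_le_of_le (by linarith) (by linarith)))
      refine ⟨?_, ha⟩
      by_contra! hcon
      rw [← Real.cos_neg] at hc'
      exact absurd hc' (not_lt.2
        (Real.cos_nonpos_of_pi_div_two_le_of_le (by linarith) (by linarith)))
    · rintro ⟨ha, hb⟩
      exact ⟨Real.cos_pos_of_mem_Ioo ⟨by linarith, hb⟩,
        Real.cos_pos_of_mem_Ioo ⟨by linarith, by linarith⟩⟩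

/-- **Sheppard's formula** for the orthant probability of a standardized Gaussian pair. -/
theorem HasGaussianLaw.orthant {Ω : Type*} [MeasurableSpace Ω] {P : Measure Ω}
    {U V : Ω → ℝ} (h : HasGaussianLaw (fun ω => (U ω, V ω)) P)
    (hU0 : ∫ ω, U ω ∂P = 0) (hV0 : ∫ ω, V ω ∂P = 0)
    (hU : Var[U; P] = 1) (hV : Var[V; P] = 1) {r : ℝ} (hr0 : -1 < r) (hr1 : r < 1)
    (hUV : cov[U, V; P] = r) :
    P.real {ω | 0 < U ω ∧ 0 < V ω} = 1 / 4 + Real.arcsin r / (2 * Real.pi) := by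
  have : IsProbabilityMeasure P := h.isProbabilityMeasure
  set s : ℝ := √(1 - r ^ 2) with hs
  have hs0 : 0 < s := Real.sqrt_pos.2 (by nlinarith)
  have hs2 : s ^ 2 = 1 - r ^ 2 := Real.sq_sqrt (by nlinarith)
  -- Gram–Schmidt: `V = r U + s W` with `W` standard normal and independent of `U`. Writing `r = cos
  -- φ`, `s = sin φ` turns the orthant into a sector.
  set W : Ω → ℝ := fun ω => s⁻¹ * (V ω - r * U ω) with hW
  have hUW : HasGaussianLaw (fun ω => (U ω, W ω)) P := by
    have := h.map_fun ((ContinuousLinearMap.fst ℝ ℝ ℝ).prod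
      (s⁻¹ • (ContinuousLinearMap.snd ℝ ℝ ℝ - r • ContinuousLinearMap.fst ℝ ℝ ℝ)))
    simpa using this
  have hUL : MemLp U 2 P := h.fst.memLp_two
  have hVL : MemLp V 2 P := h.snd.memLp_two
  have hWL : MemLp W 2 P := hUW.snd.memLp_two
  have hcov : cov[U, W; P] = 0 := by
    rw [hW, covariance_const_mul_right, covariance_fun_sub_right hUL hVL (hUL.const_mul r),
      covariance_const_mul_right, covariance_self h.fst.aemeasurable, hU, hUV]
    ring
  have hW0 : ∫ ω, W ω ∂P = 0 := by
    rw [hW, integral_const_mul, integral_sub h.snd.integrable (h.fst.integrable.const_mul r),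
      integral_const_mul, hU0, hV0]; simp
  have hW1 : Var[W; P] = 1 := by
    rw [hW, variance_const_mul, variance_fun_sub hVL (hUL.const_mul r), variance_const_mul,
      covariance_const_mul_right, covariance_comm, hUV, hU, hV]
    have : s⁻¹ ^ 2 * (1 - r ^ 2) = 1 := by
      rw [← hs2, inv_pow]; exact inv_mul_cancel₀ (by positivity)
    linarith
  have hind := hUW.indepFun_of_covariance_eq_zero hcov
  have hlaw := (indepFun_iff_map_prod_eq_prod_map_map hUW.fst.aemeasurable
    hUW.snd.aemeasurable).1 hind
  rw [hUW.fst.map_eq_gaussianReal, hUW.snd.map_eq_gaussianReal, hU0, hW0, hU, hW1] at hlaw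
  have hset : {ω | 0 < U ω ∧ 0 < V ω} = (fun ω => (U ω, W ω)) ⁻¹'
      {z | 0 < z.1 ∧ 0 < Real.cos (Real.arccos r) * z.1 + Real.sin (Real.arccos r) * z.2} := by
    ext ω
    have : r * U ω + s * W ω = V ω := by simp only [hW]; field_simp; ring
    simp only [Set.mem_ofPred_eq, Set.mem_preimage, Real.cos_arccos hr0.le hr1.le,
      Real.sin_arccos, ← hs, this]
  have hS : MeasurableSet {z : ℝ × ℝ | 0 < z.1 ∧
      0 < Real.cos (Real.arccos r) * z.1 + Real.sin (Real.arccos r) * z.2} :=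
    (measurableSet_lt measurable_const measurable_fst).inter (measurableSet_lt measurable_const
      ((measurable_fst.const_mul _).add (measurable_snd.const_mul _)))
  rw [hset, measureReal_def, ← Measure.map_apply_of_aemeasurable hUW.aemeasurable hS, hlaw,
    Real.toNNReal_one, ← measureReal_def, stdGaussian_prod_sector (Real.arccos_pos.2 hr1)]
  · rw [Real.arccos]
    have := Real.pi_pos
    field_simp; ring
  · rw [Real.arccos]
    have := Real.neg_pi_div_two_lt_arcsin.2 hr0
    linarith

/-! ### The bounded difference inequality -/

section BoundedDifferences

variable {E : Type*} [MeasurableSpace E] (μ : Measure E) [IsProbabilityMeasure μ]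

/-- Induction on the number of coordinates. Averaging over the first coordinate leaves a function
`g` with the same bounded differences, and Hoeffding's lemma in that coordinate, the others being
fixed, contributes one factor `exp(c² s² / 2)`. -/
theorem integral_exp_le_of_bounded_differences {c : ℝ} (hc : 0 ≤ c) (s : ℝ) :
    ∀ (n : ℕ) (f : (Fin n → E) → ℝ), Measurable f → (∃ K, ∀ x, |f x| ≤ K) →
      (∀ x i y, |f (Function.update x i y) - f x| ≤ c) →
      ∫ x, Real.exp (s * (f x - ∫ y, f y ∂Measure.pi fun _ => μ)) ∂(Measure.pi fun _ => μ) ≤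
        Real.exp (n * c ^ 2 * s ^ 2 / 2) := by
  intro n
  induction n with
  | zero =>
    intro f _ _ _
    have : ∀ x, f x = f default := fun x => by rw [Subsingleton.elim x default]
    simp [this]
  | succ n ih =>
    rintro f hf ⟨K, hK⟩ hd
    have mp := (measurePreserving_piFinSuccAbove (fun _ : Fin (n + 1) => μ) 0).symm
    set F : E × (Fin n → E) → ℝ := fun z => f (Fin.cons z.1 z.2) with hF
    have tr : ∀ h : ℝ → ℝ, ∫ x, h (f x) ∂(Measure.pi fun _ : Fin (n + 1) => μ) =
        ∫ z, h (F z) ∂(μ.prod (Measure.pi fun _ : Fin n => μ)) := by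
      intro h
      rw [← mp.integral_comp']
      simp [MeasurableEquiv.piFinSuccAbove_symm_apply, Fin.insertNthEquiv, hF]
    have hFm : Measurable F := by
      have := hf.comp mp.measurable
      convert! this using 1
      ext z
      simp [MeasurableEquiv.piFinSuccAbove_symm_apply, Fin.insertNthEquiv, hF]
    set g : (Fin n → E) → ℝ := fun x => ∫ y, F (y, x) ∂μ with hg
    have hFK : ∀ z, |F z| ≤ K := fun z => hK _
    have hFI : ∀ x, Integrable (fun y => F (y, x)) μ := fun x =>
      Integrable.of_bound (hFm.comp measurable_prodMk_right).aestronglyMeasurable K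
        (ae_of_all _ fun y => hFK _)
    have hgm : Measurable g :=
      (hFm.stronglyMeasurable.integral_prod_left').measurable
    have hgK : ∀ x, |g x| ≤ K := fun x => by
      have := norm_integral_le_of_norm_le_const (μ := μ) (f := fun y => F (y, x)) (C := K)
        (ae_of_all _ fun y => hFK _)
      simpa using this
    have hgd : ∀ x i y, |g (Function.update x i y) - g x| ≤ c := by
      intro x i y
      rw [hg, ← integral_sub (hFI _) (hFI _)]
      have := norm_integral_le_of_norm_le_const (μ := μ)
        (f := fun a => F (a, Function.update x i y) - F (a, x)) (C := c)
        (ae_of_all _ fun a => by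
          simp only [hF, Real.norm_eq_abs, Fin.cons_update]
          exact hd _ _ _)
      simpa using this
    have hFint : Integrable F (μ.prod (Measure.pi fun _ : Fin n => μ)) :=
      Integrable.of_bound hFm.aestronglyMeasurable K (ae_of_all _ hFK)
    have hmean : ∫ x, f x ∂(Measure.pi fun _ : Fin (n + 1) => μ) =
        ∫ x, g x ∂(Measure.pi fun _ : Fin n => μ) := by
      rw [tr fun t => t, integral_prod_symm _ hFint]
    set m := ∫ x, g x ∂(Measure.pi fun _ : Fin n => μ) with hm
    have hmK : |m| ≤ K := by
      have := norm_integral_le_of_norm_le_const (μ := Measure.pi fun _ : Fin n => μ) (f := g)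
        (C := K) (ae_of_all _ hgK)
      simpa using this
    have hexpB : ∀ a b : ℝ, |a| ≤ K → |b| ≤ K →
        ‖Real.exp (s * (a - b))‖ ≤ Real.exp (|s| * (2 * K)) := by
      intro a b ha hb
      rw [Real.norm_eq_abs, Real.abs_exp, Real.exp_le_exp]
      calc s * (a - b) ≤ |s * (a - b)| := le_abs_self _
        _ = |s| * |a - b| := abs_mul _ _
        _ ≤ |s| * (2 * K) := by
          refine mul_le_mul_of_nonneg_left ?_ (abs_nonneg _)
          calc |a - b| ≤ |a| + |b| := abs_sub _ _
            _ ≤ 2 * K := by linarith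
    have inner : ∀ x, ∫ y, Real.exp (s * (F (y, x) - g x)) ∂μ ≤ Real.exp (c ^ 2 * s ^ 2 / 2) := by
      intro x
      obtain ⟨y₀⟩ : Nonempty E := nonempty_of_isProbabilityMeasure μ
      -- The range is enclosed in an interval of length `2c` around one value, which gives variance
      -- proxy `c²`; this is where the sharp constant is lost.
      have hsub := hasSubgaussianMGF_of_mem_Icc (μ := μ) (X := fun y => F (y, x))
        (a := F (y₀, x) - c) (b := F (y₀, x) + c)
        (hFm.comp measurable_prodMk_right).aemeasurable
        (ae_of_all _ fun y => by
          have := hd (Fin.cons y₀ x) 0 y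
          rw [Fin.update_cons_zero] at this
          have := abs_le.1 this
          exact ⟨by simp only [hF]; linarith [this.1], by simp only [hF]; linarith [this.2]⟩)
      have := hsub.mgf_le s
      have e : ((‖F (y₀, x) + c - (F (y₀, x) - c)‖₊ / 2 : NNReal) : ℝ) = c := by
        push_cast
        rw [show F (y₀, x) + c - (F (y₀, x) - c) = 2 * c by ring, Real.norm_eq_abs,
          abs_of_nonneg (by linarith)]
        ring
      rw [NNReal.coe_pow, e] at this
      exact this
    rw [hmean, tr fun t => Real.exp (s * (t - m)), integral_prod_symm _
      (Integrable.of_bound (by fun_prop) (Real.exp (|s| * (2 * K)))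
        (ae_of_all _ fun z => hexpB _ _ (hFK z) hmK))]
    calc ∫ x, ∫ y, Real.exp (s * (F (y, x) - m)) ∂μ ∂(Measure.pi fun _ : Fin n => μ)
        = ∫ x, Real.exp (s * (g x - m)) * ∫ y, Real.exp (s * (F (y, x) - g x)) ∂μ
            ∂(Measure.pi fun _ : Fin n => μ) := by
          congr 1; ext x
          rw [← integral_const_mul]
          congr 1; ext y
          rw [← Real.exp_add]; congr 1; ring
      _ ≤ ∫ x, Real.exp (s * (g x - m)) * Real.exp (c ^ 2 * s ^ 2 / 2)
            ∂(Measure.pi fun _ : Fin n => μ) := by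
          refine integral_mono_of_nonneg (ae_of_all _ fun x => ?_) ?_ (ae_of_all _ fun x => ?_)
          · exact mul_nonneg (Real.exp_pos _).le (integral_nonneg fun y => (Real.exp_pos _).le)
          · exact (Integrable.of_bound (by fun_prop) (Real.exp (|s| * (2 * K)))
              (ae_of_all _ fun z => hexpB _ _ (hgK z) hmK)).mul_const _
          · exact mul_le_mul_of_nonneg_left (inner x) (Real.exp_pos _).le
      _ ≤ Real.exp (n * c ^ 2 * s ^ 2 / 2) * Real.exp (c ^ 2 * s ^ 2 / 2) := by
          rw [integral_mul_const]
          exact mul_le_mul_of_nonneg_right (ih g hgm ⟨K, hgK⟩ hgd) (Real.exp_pos _).le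
      _ = _ := by rw [← Real.exp_add]; congr 1; push_cast; ring

/-- **McDiarmid's inequality** (with a suboptimal constant). -/
theorem measureReal_le_abs_sub_integral_of_bounded_differences {c : ℝ} (hc : 0 ≤ c) {n : ℕ}
    {f : (Fin n → E) → ℝ} (hf : Measurable f) (hK : ∃ K, ∀ x, |f x| ≤ K)
    (hd : ∀ x i y, |f (Function.update x i y) - f x| ≤ c) {t : ℝ} (ht : 0 ≤ t) :
    (Measure.pi fun _ : Fin n => μ).real {x | t ≤ |f x - ∫ y, f y ∂Measure.pi fun _ => μ|} ≤
      2 * Real.exp (-t ^ 2 / (2 * (n * c ^ 2))) := by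
  set m := ∫ y, f y ∂Measure.pi fun _ : Fin n => μ
  obtain ⟨K, hK'⟩ := hK
  have hsub : HasSubgaussianMGF (fun x => f x - m) ⟨n * c ^ 2, by positivity⟩
      (Measure.pi fun _ : Fin n => μ) := by
    refine ⟨fun s => ?_, fun s => ?_⟩
    · refine integrable_exp_mul_of_mem_Icc (a := -K - m) (b := K - m) (by fun_prop)
        (ae_of_all _ fun x => ?_)
      have := abs_le.1 (hK' x)
      exact ⟨by linarith [this.1], by linarith [this.2]⟩
    · exact integral_exp_le_of_bounded_differences μ hc s n f hf ⟨K, hK'⟩ hd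
  have h1 := hsub.measure_ge_le ht
  have h2 := hsub.neg.measure_ge_le ht
  calc _ ≤ (Measure.pi fun _ : Fin n => μ).real ({x | t ≤ f x - m} ∪ {x | t ≤ -(f x - m)}) :=
        measureReal_mono fun x (hx : t ≤ |f x - m|) => le_abs.1 hx
    _ ≤ _ := measureReal_union_le _ _
    _ ≤ _ := add_le_add h1 h2
    _ = _ := (two_mul _).symm

end BoundedDifferences

/-! ### Spearman's correlation as a statistic of order three -/

/-- The number of sample points strictly below the `l`-th one. -/
noncomputable def lowerCount {n : ℕ} (v : Fin n → ℝ) (l : Fin n) : ℝ :=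
  ∑ a, if v a < v l then 1 else 0

/-- The sum of the products of the strict ranks of two samples. -/
noncomputable def rankProduct {n : ℕ} (u v : Fin n → ℝ) : ℝ :=
  ∑ l, lowerCount u l * lowerCount v l

theorem lowerCount_nonneg {n : ℕ} (v : Fin n → ℝ) (l : Fin n) : 0 ≤ lowerCount v l :=
  Finset.sum_nonneg fun _ _ => by split_ifs <;> norm_num

theorem lowerCount_le {n : ℕ} (v : Fin n → ℝ) (l : Fin n) : lowerCount v l ≤ n := by
  calc lowerCount v l ≤ ∑ _a : Fin n, (1 : ℝ) :=
        Finset.sum_le_sum fun _ _ => by split_ifs <;> norm_num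
    _ = n := by simp

theorem sampleRank_eq_lowerCount_add_one {n : ℕ} {v : Fin n → ℝ} (hv : Function.Injective v)
    (l : Fin n) : sampleRank v l = lowerCount v l + 1 := by
  have : (1 : ℝ) = ∑ a, if a = l then 1 else 0 := by simp
  rw [sampleRank, lowerCount, Finset.card_filter, this, Nat.cast_sum, ← Finset.sum_add_distrib]
  refine Finset.sum_congr rfl fun a _ => ?_
  by_cases h : a = l
  · simp [h]
  · have hne : v a ≠ v l := fun h' => h (hv h')
    by_cases h1 : v a < v l
    · simp [h, h1, h1.le]
    · have : ¬ v a ≤ v l := fun h' => h1 (lt_of_le_of_ne h' hne)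
      simp [h, h1, this]

/-- Without ties the strict ranks are a permutation of `0, …, n - 1`, as sorting the sample shows.
-/
theorem sum_comp_lowerCount {n : ℕ} {v : Fin n → ℝ} (hv : Function.Injective v) (f : ℝ → ℝ) :
    ∑ l, f (lowerCount v l) = ∑ i ∈ Finset.range n, f i := by
  have hm : StrictMono (v ∘ Tuple.sort v) :=
    (Tuple.monotone_sort v).strictMono_of_injective (hv.comp (Tuple.sort v).injective)
  rw [← Equiv.sum_comp (Tuple.sort v), Finset.sum_range]
  refine Finset.sum_congr rfl fun i _ => ?_
  congr 1
  rw [lowerCount, ← Equiv.sum_comp (Tuple.sort v)]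
  have : ∀ a, (if v (Tuple.sort v a) < v (Tuple.sort v i) then (1 : ℝ) else 0) =
      if a < i then 1 else 0 := fun a => by
    have := hm.lt_iff_lt (a := a) (b := i)
    simp only [Function.comp] at this
    simp [this]
  simp_rw [this]
  rw [Finset.sum_boole]
  simp [Finset.filter_gt_eq_Iio]

theorem sum_range_cast_id (n : ℕ) :
    ∑ i ∈ Finset.range n, (i : ℝ) = n * (n - 1) / 2 := by
  induction n with
  | zero => simp
  | succ n ih => rw [Finset.sum_range_succ, ih]; push_cast; ring

theorem sum_range_cast_sq (n : ℕ) :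
    ∑ i ∈ Finset.range n, (i : ℝ) ^ 2 = n * (n - 1) * (2 * n - 1) / 6 := by
  induction n with
  | zero => simp
  | succ n ih => rw [Finset.sum_range_succ, ih]; push_cast; ring

/-- Without ties the mean and the variance of the ranks are deterministic, so only the cross product
of the ranks is random. -/
theorem spearman_eq {n : ℕ} (hn : 2 ≤ n) {u v : Fin n → ℝ} (hu : Function.Injective u)
    (hv : Function.Injective v) :
    spearman u v =
      12 * rankProduct u v / ((n : ℝ) * ((n : ℝ) ^ 2 - 1)) - 3 * ((n : ℝ) - 1) / (n + 1) := by
  have hn' : (2 : ℝ) ≤ n := by exact_mod_cast hn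
  have hdev : ∀ w : Fin n → ℝ, Function.Injective w → ∀ l,
      sampleRank w l - sampleMean (sampleRank w) = lowerCount w l - (n - 1) / 2 := by
    intro w hw l
    have : sampleMean (sampleRank w) = (n + 1) / 2 := by
      rw [sampleMean]
      simp_rw [sampleRank_eq_lowerCount_add_one hw]
      rw [sum_comp_lowerCount hw fun x => x + 1, Finset.sum_add_distrib, sum_range_cast_id]
      simp
      field_simp
      ring
    rw [this, sampleRank_eq_lowerCount_add_one hw]; ring
  have hsq : ∀ w : Fin n → ℝ, Function.Injective w →
      ∑ l, (lowerCount w l - (n - 1) / 2) ^ 2 = (n : ℝ) * ((n : ℝ) ^ 2 - 1) / 12 := by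
    intro w hw
    rw [sum_comp_lowerCount hw fun x => (x - ((n : ℝ) - 1) / 2) ^ 2]
    have e : ∀ i : ℕ, ((i : ℝ) - ((n : ℝ) - 1) / 2) ^ 2 =
        (i : ℝ) ^ 2 - ((n : ℝ) - 1) * i + (((n : ℝ) - 1) / 2) ^ 2 := fun i => by ring
    simp_rw [e, Finset.sum_add_distrib, Finset.sum_sub_distrib, ← Finset.mul_sum,
      sum_range_cast_id, sum_range_cast_sq]
    simp
    ring
  have hprod : ∑ l, (lowerCount u l - (n - 1) / 2) * (lowerCount v l - (n - 1) / 2) =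
      rankProduct u v - (n : ℝ) * ((n : ℝ) - 1) ^ 2 / 4 := by
    have hs : ∀ w : Fin n → ℝ, Function.Injective w → ∑ l, lowerCount w l = n * (n - 1) / 2 :=
      fun w hw => by rw [sum_comp_lowerCount hw fun x => x, sum_range_cast_id]
    simp_rw [sub_mul, mul_sub, Finset.sum_sub_distrib, ← Finset.mul_sum, ← Finset.sum_mul,
      hs u hu, hs v hv, rankProduct]
    simp
    ring
  have hD : (0 : ℝ) < n * (n ^ 2 - 1) := mul_pos (by linarith) (by nlinarith)
  unfold spearman pearson
  simp_rw [hdev u hu, hdev v hv]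
  rw [hsq u hu, hsq v hv, hprod, Real.mul_self_sqrt (by positivity)]
  have h1 : (n : ℝ) ^ 2 - 1 ≠ 0 := by nlinarith
  have h2 : (n : ℝ) + 1 ≠ 0 := by linarith
  have h3 : (n : ℝ) ≠ 0 := by linarith
  field_simp
  ring

theorem rankProduct_nonneg {n : ℕ} (u v : Fin n → ℝ) : 0 ≤ rankProduct u v :=
  Finset.sum_nonneg fun _ _ => mul_nonneg (lowerCount_nonneg _ _) (lowerCount_nonneg _ _)

theorem rankProduct_le {n : ℕ} (u v : Fin n → ℝ) : rankProduct u v ≤ (n : ℝ) ^ 3 := by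
  calc rankProduct u v ≤ ∑ _l : Fin n, (n : ℝ) * n :=
        Finset.sum_le_sum fun l _ => mul_le_mul (lowerCount_le u l) (lowerCount_le v l)
          (lowerCount_nonneg _ _) (Nat.cast_nonneg _)
    _ = (n : ℝ) ^ 3 := by simp; ring

theorem abs_spearman_sub_le {n : ℕ} (hn : 2 ≤ n) {u v : Fin n → ℝ} (hu : Function.Injective u)
    (hv : Function.Injective v) :
    |spearman u v - (12 * (rankProduct u v / (n : ℝ) ^ 3) - 3)| ≤ 18 / (n : ℝ) := by
  have hn' : (2 : ℝ) ≤ n := by exact_mod_cast hn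
  have h0 := rankProduct_nonneg u v
  have h1 := rankProduct_le u v
  rw [spearman_eq hn hu hv]
  set S := rankProduct u v
  have hs : (0 : ℝ) < n ^ 2 - 1 := by nlinarith
  have h4 : (0 : ℝ) < n + 1 := by linarith
  have h3 : (0 : ℝ) < n := by linarith
  have e : 12 * S / (n * (n ^ 2 - 1)) - 3 * (n - 1) / (n + 1) - (12 * (S / n ^ 3) - 3) =
      12 * (S / n ^ 3) / (n ^ 2 - 1) + 6 / (n + 1) := by
    have := hs.ne'
    field_simp
    ring
  have hS1 : S / n ^ 3 ≤ 1 := (div_le_one (by positivity)).2 h1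
  rw [e, abs_of_nonneg (by positivity)]
  calc 12 * (S / n ^ 3) / (n ^ 2 - 1) + 6 / ((n : ℝ) + 1) ≤ 12 / n + 6 / n := by
        refine add_le_add ?_ ?_
        · exact div_le_div₀ (by norm_num) (by linarith) h3 (by nlinarith)
        · exact div_le_div_of_nonneg_left (by norm_num) h3 (by linarith)
    _ = 18 / n := by ring

section Statistic

variable {E : Type*} {φ ψ : E → ℝ} {n : ℕ}

theorem abs_lowerCount_update_sub_le (φ : E → ℝ) (x : Fin n → E) {i l : Fin n} (h : l ≠ i)
    (y : E) : |lowerCount (φ ∘ Function.update x i y) l - lowerCount (φ ∘ x) l| ≤ 1 := by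
  rw [lowerCount, lowerCount, ← Finset.sum_sub_distrib, Finset.sum_eq_single i]
  · split_ifs <;> norm_num
  · intro a _ ha
    simp [Function.update_of_ne ha, Function.update_of_ne h]
  · simp

/-- The summand of the replaced observation moves by at most `n²`. In each of the other summands
both counts move by at most one, which costs at most `2n`. -/
theorem abs_rankProduct_update_sub_le (φ ψ : E → ℝ) (x : Fin n → E) (i : Fin n) (y : E) :
    |rankProduct (φ ∘ Function.update x i y) (ψ ∘ Function.update x i y) -
      rankProduct (φ ∘ x) (ψ ∘ x)| ≤ 3 * (n : ℝ) ^ 2 := by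
  set x' := Function.update x i y with hx'
  have hb : ∀ w : Fin n → ℝ, ∀ l, |lowerCount w l| ≤ n := fun w l => by
    rw [abs_of_nonneg (lowerCount_nonneg w l)]; exact lowerCount_le w l
  have key : ∀ l, |lowerCount (φ ∘ x') l * lowerCount (ψ ∘ x') l -
      lowerCount (φ ∘ x) l * lowerCount (ψ ∘ x) l| ≤
      2 * n + if l = i then (n : ℝ) ^ 2 else 0 := by
    intro l
    by_cases h : l = i
    · rw [if_pos h]
      have hp : ∀ w w' : Fin n → ℝ, 0 ≤ lowerCount w l * lowerCount w' l ∧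
          lowerCount w l * lowerCount w' l ≤ n ^ 2 := fun w w' =>
        ⟨mul_nonneg (lowerCount_nonneg _ _) (lowerCount_nonneg _ _), by
          rw [sq]
          exact mul_le_mul (lowerCount_le w l) (lowerCount_le w' l)
            (lowerCount_nonneg _ _) (Nat.cast_nonneg _)⟩
      have := hp (φ ∘ x') (ψ ∘ x')
      have := hp (φ ∘ x) (ψ ∘ x)
      have : (0 : ℝ) ≤ n := Nat.cast_nonneg _
      rw [abs_le]; constructor <;> linarith
    · rw [if_neg h, add_zero]
      have h1 := abs_lowerCount_update_sub_le φ x h y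
      have h2 := abs_lowerCount_update_sub_le ψ x h y
      rw [← hx'] at h1 h2
      calc _ = |(lowerCount (φ ∘ x') l - lowerCount (φ ∘ x) l) * lowerCount (ψ ∘ x') l +
            lowerCount (φ ∘ x) l * (lowerCount (ψ ∘ x') l - lowerCount (ψ ∘ x) l)| := by
              congr 1; ring
        _ ≤ _ := abs_add_le _ _
        _ ≤ 1 * n + n * 1 := by
          rw [abs_mul, abs_mul]
          exact add_le_add (mul_le_mul h1 (hb _ _) (abs_nonneg _) zero_le_one)
            (mul_le_mul (hb _ _) h2 (abs_nonneg _) (Nat.cast_nonneg _))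
        _ = 2 * n := by ring
  rw [rankProduct, rankProduct, ← Finset.sum_sub_distrib]
  calc _ ≤ ∑ l, (2 * n + if l = i then (n : ℝ) ^ 2 else 0) :=
        (Finset.abs_sum_le_sum_abs _ _).trans (Finset.sum_le_sum fun l _ => key l)
    _ = 3 * (n : ℝ) ^ 2 := by
      rw [Finset.sum_add_distrib]; simp; ring

variable [MeasurableSpace E]

theorem measurable_rankProduct (hφ : Measurable φ) (hψ : Measurable ψ) :
    Measurable fun x : Fin n → E => rankProduct (φ ∘ x) (ψ ∘ x) := by
  have h : ∀ {φ : E → ℝ}, Measurable φ → ∀ l,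
      Measurable fun x : Fin n → E => lowerCount (φ ∘ x) l := by
    intro φ hφ l
    refine Finset.measurable_sum _ fun a _ => ?_
    exact Measurable.ite (measurableSet_lt (hφ.comp (measurable_pi_apply a))
      (hφ.comp (measurable_pi_apply l))) measurable_const measurable_const
  exact Finset.measurable_sum _ fun l _ => (h hφ l).mul (h hψ l)

variable {μ : Measure E} [IsProbabilityMeasure μ]

/-- The statistic is a sum of indicators over triples `(l, a, b)`. Distinct triples contribute
exactly `θ`; at most `3n²` triples have a coincidence, and each of these errs by at most one. -/
theorem abs_integral_rankProduct_sub_le (hφ : Measurable φ) (hψ : Measurable ψ) {θ : ℝ}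
    (hθ : ∀ l a b : Fin n, l ≠ a → l ≠ b → a ≠ b → (Measure.pi fun _ : Fin n => μ).real
      {x | φ (x a) < φ (x l) ∧ ψ (x b) < ψ (x l)} = θ) (hθ0 : 0 ≤ θ) (hθ1 : θ ≤ 1) :
    |∫ x, rankProduct (φ ∘ x) (ψ ∘ x) ∂(Measure.pi fun _ : Fin n => μ) - n ^ 3 * θ| ≤
      3 * (n : ℝ) ^ 2 := by
  set π := Measure.pi fun _ : Fin n => μ with hπ
  let D : Fin n → Fin n → Fin n → Set (Fin n → E) := fun l a b =>
    {x | φ (x a) < φ (x l) ∧ ψ (x b) < ψ (x l)}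
  have hD : ∀ l a b, MeasurableSet (D l a b) := fun l a b =>
    (measurableSet_lt (hφ.comp (measurable_pi_apply a)) (hφ.comp (measurable_pi_apply l))).inter
      (measurableSet_lt (hψ.comp (measurable_pi_apply b)) (hψ.comp (measurable_pi_apply l)))
  have e : ∀ x, rankProduct (φ ∘ x) (ψ ∘ x) =
      ∑ l, ∑ a, ∑ b, (D l a b).indicator (1 : (Fin n → E) → ℝ) x := by
    intro x
    rw [rankProduct]
    refine Finset.sum_congr rfl fun l _ => ?_
    rw [lowerCount, lowerCount, Finset.sum_mul_sum]
    refine Finset.sum_congr rfl fun a _ => Finset.sum_congr rfl fun b _ => ?_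
    by_cases h1 : φ (x a) < φ (x l) <;> by_cases h2 : ψ (x b) < ψ (x l)
    all_goals simp [D, Set.indicator, h1, h2]
  have hI : ∀ l a b, Integrable ((D l a b).indicator (1 : (Fin n → E) → ℝ)) π := fun l a b =>
    (integrable_const (1 : ℝ)).indicator (hD l a b)
  have hint : ∫ x, rankProduct (φ ∘ x) (ψ ∘ x) ∂π = ∑ l, ∑ a, ∑ b, π.real (D l a b) := by
    simp_rw [e]
    rw [integral_finsetSum _ fun l _ => integrable_finsetSum _ fun a _ =>
      integrable_finsetSum _ fun b _ => hI l a b]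
    refine Finset.sum_congr rfl fun l _ => ?_
    rw [integral_finsetSum _ fun a _ => integrable_finsetSum _ fun b _ => hI l a b]
    refine Finset.sum_congr rfl fun a _ => ?_
    rw [integral_finsetSum _ fun b _ => hI l a b]
    exact Finset.sum_congr rfl fun b _ => integral_indicator_one (hD l a b)
  have hc : (n : ℝ) ^ 3 * θ = ∑ _l : Fin n, ∑ _a : Fin n, ∑ _b : Fin n, θ := by simp; ring
  have key : ∀ l a b : Fin n, |π.real (D l a b) - θ| ≤
      (if l = a then 1 else 0) + (if l = b then 1 else 0) + (if a = b then 1 else 0) := by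
    intro l a b
    by_cases h : l ≠ a ∧ l ≠ b ∧ a ≠ b
    · rw [hθ l a b h.1 h.2.1 h.2.2]
      simp [h.1, h.2.1, h.2.2]
    · have h0 : 0 ≤ π.real (D l a b) := measureReal_nonneg
      have h1 : π.real (D l a b) ≤ 1 := measureReal_le_one
      have : |π.real (D l a b) - θ| ≤ 1 := by rw [abs_le]; constructor <;> linarith
      refine this.trans ?_
      by_cases h1 : l = a
      · rw [if_pos h1]; split_ifs <;> norm_num
      · by_cases h2 : l = b
        · rw [if_pos h2]; split_ifs <;> norm_num
        · have h3 : a = b := by_contra fun h3 => h ⟨h1, h2, h3⟩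
          rw [if_pos h3]; split_ifs <;> norm_num
  rw [hint, hc]
  simp_rw [← Finset.sum_sub_distrib]
  calc _ ≤ ∑ l : Fin n, ∑ a : Fin n, ∑ b : Fin n, ((if l = a then (1 : ℝ) else 0) +
        (if l = b then 1 else 0) + (if a = b then 1 else 0)) :=
        (Finset.abs_sum_le_sum_abs _ _).trans <| Finset.sum_le_sum fun l _ =>
        (Finset.abs_sum_le_sum_abs _ _).trans <| Finset.sum_le_sum fun a _ =>
        (Finset.abs_sum_le_sum_abs _ _).trans <| Finset.sum_le_sum fun b _ => key l a b
    _ = 3 * (n : ℝ) ^ 2 := by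
      simp [Finset.sum_add_distrib]; ring

/-- The bounded difference inequality with `c = 3n²` at level `n³ t` gives the exponent `n t² / 18`;
the term `3/n` absorbs the bias. -/
theorem measureReal_lt_abs_rankProduct_sub_le (hn : 1 ≤ n) (hφ : Measurable φ)
    (hψ : Measurable ψ) {θ : ℝ}
    (hθ : ∀ l a b : Fin n, l ≠ a → l ≠ b → a ≠ b → (Measure.pi fun _ : Fin n => μ).real
      {x | φ (x a) < φ (x l) ∧ ψ (x b) < ψ (x l)} = θ) (hθ0 : 0 ≤ θ) (hθ1 : θ ≤ 1)
    {t : ℝ} (ht : 0 ≤ t) :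
    (Measure.pi fun _ : Fin n => μ).real
      {x | t + 3 / n ≤ |rankProduct (φ ∘ x) (ψ ∘ x) / n ^ 3 - θ|} ≤
      2 * Real.exp (-(n * t ^ 2) / 18) := by
  have hn' : (0 : ℝ) < n := by exact_mod_cast hn
  set π := Measure.pi fun _ : Fin n => μ with hπ
  have h := measureReal_le_abs_sub_integral_of_bounded_differences μ (n := n) (c := 3 * n ^ 2)
    (f := fun x => rankProduct (φ ∘ x) (ψ ∘ x)) (by positivity) (measurable_rankProduct hφ hψ)
    ⟨n ^ 3, fun x => by
      rw [abs_of_nonneg (rankProduct_nonneg _ _)]; exact rankProduct_le _ _⟩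
    (abs_rankProduct_update_sub_le φ ψ) (t := n ^ 3 * t) (by positivity)
  have hE := abs_integral_rankProduct_sub_le (μ := μ) hφ hψ hθ hθ0 hθ1
  rw [← hπ] at h hE
  set m := ∫ x, rankProduct (φ ∘ x) (ψ ∘ x) ∂π
  refine (measureReal_mono ?_).trans (h.trans (le_of_eq ?_))
  · intro x hx
    simp only [Set.mem_ofPred_eq] at hx ⊢
    have e : rankProduct (φ ∘ x) (ψ ∘ x) / n ^ 3 - θ =
        (rankProduct (φ ∘ x) (ψ ∘ x) - n ^ 3 * θ) / n ^ 3 := by field_simp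
    rw [e, abs_div, abs_of_pos (a := (n : ℝ) ^ 3) (by positivity), le_div_iff₀ (by positivity)] at hx
    have h1 : (t + 3 / n) * (n : ℝ) ^ 3 = n ^ 3 * t + 3 * n ^ 2 := by field_simp
    rw [h1] at hx
    have h2 := abs_sub_le (rankProduct (φ ∘ x) (ψ ∘ x)) m (n ^ 3 * θ)
    linarith
  · congr 2
    field_simp
    ring

end Statistic

/-! ### Concentration of the adjusted Spearman correlation of a Gaussian sample -/

section GaussianSample

variable {p n : ℕ} {Sig : Matrix (Fin p) (Fin p) ℝ}

/-- The law of `n` independent observations of `N(0, Sig)`. -/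
noncomputable abbrev gaussianSample (n : ℕ) {p : ℕ} (Sig : Matrix (Fin p) (Fin p) ℝ) :
    Measure (Fin n → EuclideanSpace ℝ (Fin p)) :=
  Measure.pi fun _ => multivariateGaussian 0 Sig

theorem hasGaussianLaw_gaussianSample :
    HasGaussianLaw (fun x : Fin n → EuclideanSpace ℝ (Fin p) => fun l => x l)
      (gaussianSample n Sig) :=
  iIndepFun.hasGaussianLaw
    (fun l => ((measurePreserving_eval (fun _ : Fin n => multivariateGaussian 0 Sig) l).hasLaw).hasGaussianLaw)
    (iIndepFun_pi (X := fun _ x => x) fun _ => aemeasurable_id)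

/-- The `i`-th coordinate of the `l`-th observation. -/
noncomputable abbrev sampleCoord (n : ℕ) {p : ℕ} (l : Fin n) (i : Fin p) :
    (Fin n → EuclideanSpace ℝ (Fin p)) →L[ℝ] ℝ :=
  (EuclideanSpace.proj i).comp (ContinuousLinearMap.proj l)

theorem hasGaussianLaw_sampleCoord (L : (Fin n → EuclideanSpace ℝ (Fin p)) →L[ℝ] ℝ) :
    HasGaussianLaw L (gaussianSample n Sig) :=
  hasGaussianLaw_gaussianSample.map L

theorem integral_sampleCoord (hS : Sig.PosSemidef) (l : Fin n) (i : Fin p) :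
    ∫ x, x l i ∂(gaussianSample n Sig) = 0 := by
  have h1 := (measurePreserving_eval_multivariateGaussian (μ := 0) hS (i := i)).comp
    (measurePreserving_eval (fun _ : Fin n => multivariateGaussian 0 Sig) l)
  have h2 := integral_map (μ := gaussianSample n Sig) h1.measurable.aemeasurable
    (f := fun y : ℝ => y) (by fun_prop)
  rw [h1.map_eq] at h2
  simpa using h2.symm

theorem covariance_sampleCoord (hS : Sig.PosSemidef) (l m : Fin n) (i j : Fin p) :
    cov[fun x => x l i, fun x => x m j; gaussianSample n Sig] = if l = m then Sig i j else 0 := by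
  split_ifs with h
  · subst h
    have mp := measurePreserving_eval (fun _ : Fin n => multivariateGaussian 0 Sig) l
    have hm : ∀ i, Measurable fun y : EuclideanSpace ℝ (Fin p) => y i := fun i => by fun_prop
    have := covariance_map_fun (μ := gaussianSample n Sig) (hm i).aestronglyMeasurable
      (hm j).aestronglyMeasurable mp.measurable.aemeasurable
    rw [mp.map_eq, covariance_eval_multivariateGaussian hS] at this
    exact this.symm
  · have hind := (iIndepFun_pi (μ := fun _ : Fin n => multivariateGaussian 0 Sig)
      (X := fun _ x => x) fun _ => aemeasurable_id).indepFun h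
    have := hind.comp (φ := fun y : EuclideanSpace ℝ (Fin p) => y i)
      (ψ := fun y : EuclideanSpace ℝ (Fin p) => y j) (by fun_prop) (by fun_prop)
    exact this.covariance_eq_zero (hasGaussianLaw_sampleCoord (sampleCoord n l i)).memLp_two
      (hasGaussianLaw_sampleCoord (sampleCoord n m j)).memLp_two

theorem memLp_sampleCoord (l : Fin n) (i : Fin p) :
    MemLp (fun x => x l i) 2 (gaussianSample n Sig) :=
  (hasGaussianLaw_sampleCoord (sampleCoord n l i)).memLp_two

theorem covariance_sampleCoord_sub (hS : Sig.PosSemidef) (l a m b : Fin n) (i j : Fin p) :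
    cov[fun x => x l i - x a i, fun x => x m j - x b j; gaussianSample n Sig] =
      (if l = m then Sig i j else 0) - (if l = b then Sig i j else 0) -
      (if a = m then Sig i j else 0) + (if a = b then Sig i j else 0) := by
  rw [covariance_fun_sub_fun_sub (memLp_sampleCoord l i) (memLp_sampleCoord a i)
    (memLp_sampleCoord m j) (memLp_sampleCoord b j)]
  simp only [covariance_sampleCoord hS]

theorem variance_sampleCoord_sub (hS : Sig.PosSemidef) {l a : Fin n} (h : l ≠ a) (i : Fin p) :
    Var[fun x => x l i - x a i; gaussianSample n Sig] = 2 * Sig i i := by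
  rw [← covariance_self (by fun_prop), covariance_sampleCoord_sub hS]
  simp [h, h.symm]
  ring

/-- Almost surely, there are no ties in a coordinate of a Gaussian sample. -/
theorem ae_injective_gaussianSample (hS : Sig.PosSemidef) {i : Fin p} (hi : Sig i i = 1) :
    ∀ᵐ x ∂(gaussianSample n Sig), Function.Injective fun l => x l i := by
  have : ∀ l a : Fin n, l ≠ a → ∀ᵐ x ∂(gaussianSample n Sig), x l i ≠ x a i := by
    intro l a h
    have hG := hasGaussianLaw_sampleCoord (Sig := Sig) (sampleCoord n l i - sampleCoord n a i)
    have hlaw := hG.map_eq_gaussianReal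
    have hv : Var[(sampleCoord n l i - sampleCoord n a i : (Fin n → EuclideanSpace ℝ (Fin p)) →L[ℝ] ℝ);
        gaussianSample n Sig] = 2 := by
      have := variance_sampleCoord_sub hS h i
      rw [hi, mul_one] at this
      exact this
    rw [hv] at hlaw
    have h0 := nullSingletonClass_gaussianReal (v := (2 : ℝ).toNNReal)
      (μ := ∫ x, (sampleCoord n l i - sampleCoord n a i) x ∂(gaussianSample n Sig)) (by simp)
    rw [← hlaw] at h0
    have h1 := h0.measure_singleton (0 : ℝ)
    rw [Measure.map_apply (by fun_prop) (measurableSet_singleton _)] at h1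
    refine measure_mono_null (fun x hx => ?_) h1
    have hx' : x l i = x a i := by simpa using hx
    simp [hx']
  have h' : ∀ᵐ x ∂(gaussianSample n Sig), ∀ l a : Fin n, l ≠ a → x l i ≠ x a i := by
    simp_rw [ae_all_iff]
    exact this
  filter_upwards [h'] with x hx l a hla
  by_contra hne
  exact hx l a hne hla

/-- Evaluate the quadratic form at `e_i + e_j` and `e_i - e_j`. -/
theorem PosSemidef.abs_apply_le_one (hS : Sig.PosSemidef) (hd : ∀ j, Sig j j = 1)
    (i j : Fin p) : |Sig i j| ≤ 1 := by
  have hij : Sig j i = Sig i j := by simpa using hS.1.apply i j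
  have key : ∀ s : ℝ, s ^ 2 = 1 → 0 ≤ 2 + 2 * s * Sig i j := by
    intro s hs
    have := hS.dotProduct_mulVec_nonneg (Pi.single i 1 + Pi.single j s)
    simp [Matrix.mulVec_add, dotProduct_add, add_dotProduct, hd, hij] at this
    nlinarith
  have h1 := key 1 (by norm_num)
  have h2 := key (-1) (by norm_num)
  rw [abs_le]; constructor <;> linarith

/-- The two differences share only the observation `l`: their covariance is `Sig i j` and their
variances are `2`, so the correlation in Sheppard's formula is halved. -/
theorem gaussianSample_concordance (hS : Sig.PosSemidef) (hd : ∀ j, Sig j j = 1) (i j : Fin p)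
    {l a b : Fin n} (hla : l ≠ a) (hlb : l ≠ b) (hab : a ≠ b) :
    (gaussianSample n Sig).real {x | x a i < x l i ∧ x b j < x l j} =
      1 / 4 + Real.arcsin (Sig i j / 2) / (2 * Real.pi) := by
  set c : ℝ := (√2)⁻¹ with hc
  have hc0 : 0 < c := by positivity
  have hc2 : c * c = 1 / 2 := by
    rw [hc, ← mul_inv, Real.mul_self_sqrt (by norm_num)]; norm_num
  have hle := abs_le.1 (PosSemidef.abs_apply_le_one hS hd i j)
  have hpair : HasGaussianLaw (fun x : Fin n → EuclideanSpace ℝ (Fin p) =>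
      (c * (x l i - x a i), c * (x l j - x b j))) (gaussianSample n Sig) :=
    hasGaussianLaw_gaussianSample.map_fun ((c • (sampleCoord n l i - sampleCoord n a i)).prod
      (c • (sampleCoord n l j - sampleCoord n b j)))
  have hI : ∀ (l : Fin n) (i : Fin p), Integrable (fun x => x l i) (gaussianSample n Sig) :=
    fun l i => (hasGaussianLaw_sampleCoord (sampleCoord n l i)).integrable
  have h0 : ∀ (l a : Fin n) (i : Fin p), ∫ x, c * (x l i - x a i) ∂(gaussianSample n Sig) = 0 := by
    intro l a i
    rw [integral_const_mul, integral_sub (hI l i) (hI a i), integral_sampleCoord hS,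
      integral_sampleCoord hS]
    simp
  have h1 : ∀ {l a : Fin n} (_ : l ≠ a) (i : Fin p),
      Var[fun x => c * (x l i - x a i); gaussianSample n Sig] = 1 := by
    intro l a h i
    rw [variance_const_mul, variance_sampleCoord_sub hS h, hd, sq, hc2]; norm_num
  have := HasGaussianLaw.orthant hpair (h0 l a i) (h0 l b j) (h1 hla i) (h1 hlb j)
    (r := Sig i j / 2) (by linarith [hle.1]) (by linarith [hle.2]) (by
      rw [covariance_const_mul_left, covariance_const_mul_right, covariance_sampleCoord_sub hS,
        ← mul_assoc, hc2]
      simp [hab, hlb, hla.symm]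
      ring)
  simpa [hc0, mul_pos_iff_of_pos_left] using this

/-- Since `2 sin(π/6 · )` is `2`-Lipschitz, a deviation above `t` forces `t < 36/n + 24 |S/n³ - θ|`.
The condition `216/n ≤ t` then leaves room for the level `t/48 + 3/n`, and `41472 = 18 · 48²`. -/
theorem measureReal_rank_deviation_le (hS : Sig.PosSemidef) (hd : ∀ j, Sig j j = 1)
    (i j : Fin p) (hn : 2 ≤ n) {t : ℝ} (ht : 216 / n ≤ t) :
    (gaussianSample n Sig).real {x | t < |2 * Real.sin (Real.pi / 6 *
      spearman (fun l => x l i) (fun l => x l j)) - Sig i j|} ≤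
      2 * Real.exp (-(n * t ^ 2) / 41472) := by
  have hn' : (2 : ℝ) ≤ n := by exact_mod_cast hn
  have ht0 : 0 < t := lt_of_lt_of_le (by positivity) ht
  have hle := abs_le.1 (PosSemidef.abs_apply_le_one hS hd i j)
  have hpi := Real.pi_pos
  set θ : ℝ := 1 / 4 + Real.arcsin (Sig i j / 2) / (2 * Real.pi) with hθ
  have hconc : ∀ l a b : Fin n, l ≠ a → l ≠ b → a ≠ b →
      (gaussianSample n Sig).real {x | x a i < x l i ∧ x b j < x l j} = θ :=
    fun l a b h1 h2 h3 => gaussianSample_concordance hS hd i j h1 h2 h3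
  have ha1 := Real.neg_pi_div_two_le_arcsin (Sig i j / 2)
  have ha2 := Real.arcsin_le_pi_div_two (Sig i j / 2)
  have hb1 : -(1 / 4) ≤ Real.arcsin (Sig i j / 2) / (2 * Real.pi) := by
    rw [le_div_iff₀ (by positivity)]; linarith
  have hb2 : Real.arcsin (Sig i j / 2) / (2 * Real.pi) ≤ 1 / 4 := by
    rw [div_le_iff₀ (by positivity)]; linarith
  have hρ : 2 * Real.sin (Real.pi / 6 * (12 * θ - 3)) = Sig i j := by
    have : Real.pi / 6 * (12 * θ - 3) = Real.arcsin (Sig i j / 2) := by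
      rw [hθ]; field_simp; ring
    rw [this, Real.sin_arcsin (by linarith [hle.1]) (by linarith [hle.2])]; ring
  have main := measureReal_lt_abs_rankProduct_sub_le (μ := multivariateGaussian 0 Sig) (n := n)
    (φ := fun y : EuclideanSpace ℝ (Fin p) => y i) (ψ := fun y => y j) (by omega)
    (by fun_prop) (by fun_prop) hconc (by rw [hθ]; linarith) (by rw [hθ]; linarith)
    (t := t / 48) (by positivity)
  have hexp : -(n * (t / 48) ^ 2) / 18 = -(n * t ^ 2) / 41472 := by ring
  rw [hexp] at main
  refine le_trans ?_ main
  refine ENNReal.toReal_mono (measure_ne_top _ _) (measure_mono_ae ?_)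
  filter_upwards [ae_injective_gaussianSample (n := n) hS (hd i),
    ae_injective_gaussianSample (n := n) hS (hd j)] with x hxi hxj hx
  change t < |2 * Real.sin (Real.pi / 6 *
      spearman (fun l => x l i) (fun l => x l j)) - Sig i j| at hx
  change t / 48 + 3 / n ≤ |rankProduct (fun l => x l i) (fun l => x l j) / n ^ 3 - θ|
  have hs := abs_spearman_sub_le hn hxi hxj
  set s := spearman (fun l => x l i) (fun l => x l j)
  set S := rankProduct (fun l => x l i) (fun l => x l j)
  rw [← hρ, ← mul_sub, abs_mul, abs_two] at hx
  have hsin : |Real.sin (Real.pi / 6 * s) - Real.sin (Real.pi / 6 * (12 * θ - 3))| ≤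
      |s - (12 * θ - 3)| := by
    refine (Real.abs_sin_sub_sin_le _ _).trans ?_
    rw [← mul_sub, abs_mul, abs_of_pos (by positivity)]
    exact mul_le_of_le_one_left (abs_nonneg _) (by linarith [Real.pi_le_four])
  have htri : |s - (12 * θ - 3)| ≤ 18 / n + 12 * |S / n ^ 3 - θ| := by
    have e : s - (12 * θ - 3) = (s - (12 * (S / n ^ 3) - 3)) + 12 * (S / n ^ 3 - θ) := by ring
    rw [e]
    refine (abs_add_le _ _).trans (add_le_add hs ?_)
    rw [abs_mul, abs_of_pos (by norm_num : (0 : ℝ) < 12)]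
  have h3 : (3 : ℝ) / n = (216 / n) / 72 := by ring
  have h18 : (18 : ℝ) / n = (216 / n) / 12 := by ring
  rw [h3]; rw [h18] at htri
  nlinarith

end GaussianSample

/-! ### Concentration for nonparanormal samples -/

theorem sampleRank_congr {n : ℕ} {u v : Fin n → ℝ} (h : ∀ l m, u l ≤ u m ↔ v l ≤ v m) :
    sampleRank u = sampleRank v := by
  ext l
  simp only [sampleRank, h]

/-- Monotonicity need not be strict: the absence of ties among the transformed values excludes flat
pieces between sample points. -/
theorem sampleRank_comp_monotoneOn {n : ℕ} {u : Fin n → ℝ} {I : Set ℝ} {f : ℝ → ℝ}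
    (hf : MonotoneOn f I) (hu : ∀ l, u l ∈ I) (hinj : Function.Injective fun l => f (u l)) :
    sampleRank u = sampleRank fun l => f (u l) := by
  refine sampleRank_congr fun l m => ⟨fun h => hf (hu l) (hu m) h, fun h => ?_⟩
  by_contra! hlt
  have := hinj (le_antisymm h (hf (hu m) (hu l) hlt.le))
  exact absurd hlt (by rw [this]; exact lt_irrefl _)

theorem measure_rankMatrix_deviation_le {Ω : Type*} [MeasurableSpace Ω] {P : Measure Ω}
    [IsProbabilityMeasure P] {n p : ℕ} {Sig : Matrix (Fin p) (Fin p) ℝ}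
    {μ : Measure (Fin p → ℝ)} {X : Fin n → Ω → Fin p → ℝ} (hS : Sig.PosSemidef)
    (hd : ∀ j, Sig j j = 1) (hμ : IsNonparanormal μ Sig) (hX : ∀ l, Measurable (X l))
    (hlaw : ∀ l, P.map (X l) = μ) (hind : iIndepFun X P) (hn : 2 ≤ n) (i j : Fin p)
    {t : ℝ} (ht : 216 / n ≤ t) :
    P {ω | t < |rankMatrix (fun l => X l ω) i j - Sig i j|} ≤
      ENNReal.ofReal (2 * Real.exp (-(n * t ^ 2) / 41472)) := by
  obtain ⟨f, I, hf, hI, hmap⟩ := hμ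
  set F : (Fin p → ℝ) → EuclideanSpace ℝ (Fin p) := fun x => WithLp.toLp 2 fun j => f j (x j)
    with hF
  -- Measurability is not part of the model but follows from it: the push-forward along a map that
  -- is not a.e. measurable is zero by convention, and a Gaussian law is not zero.
  have hFm : AEMeasurable F μ := by
    by_contra h
    rw [Measure.map_of_not_aemeasurable h] at hmap
    exact (IsProbabilityMeasure.ne_zero (multivariateGaussian 0 Sig)) hmap.symm
  set Y : Ω → Fin n → EuclideanSpace ℝ (Fin p) := fun ω l => hFm.mk F (X l ω) with hY
  have hYm : ∀ l, Measurable fun ω => hFm.mk F (X l ω) :=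
    fun l => hFm.measurable_mk.comp (hX l)
  have hYlaw : P.map Y = gaussianSample n Sig := by
    have h := (hind.comp (fun _ => hFm.mk F) fun _ => hFm.measurable_mk).map_fun_eq_pi_map
      fun l => (hYm l).aemeasurable
    refine h.trans ?_
    congr 1
    ext1 l
    change P.map (hFm.mk F ∘ X l) = _
    rw [← Measure.map_map hFm.measurable_mk (hX l), hlaw, ← hmap]
    exact Measure.map_congr hFm.ae_eq_mk.symm
  have hYm' : Measurable Y := measurable_pi_lambda _ hYm
  have hae : ∀ {Q : (Fin p → ℝ) → Prop}, (∀ᵐ x ∂μ, Q x) → ∀ᵐ ω ∂P, ∀ l, Q (X l ω) := by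
    intro Q hQ
    refine ae_all_iff.2 fun l => ae_of_ae_map (hX l).aemeasurable ?_
    rwa [hlaw]
  have hinj : ∀ i, ∀ᵐ ω ∂P, Function.Injective fun l => Y ω l i := fun i => by
    refine ae_of_ae_map hYm'.aemeasurable ?_ (p := fun y => Function.Injective fun l => y l i)
    rw [hYlaw]
    exact ae_injective_gaussianSample hS (hd i)
  have hrank : ∀ i, ∀ᵐ ω ∂P,
      sampleRank (fun l => X l ω i) = sampleRank fun l => Y ω l i := fun i => by
    filter_upwards [hae (hI i), hae hFm.ae_eq_mk, hinj i] with ω h1 h2 h3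
    have e : (fun l => Y ω l i) = fun l => f i (X l ω i) := by
      ext l
      change (hFm.mk F (X l ω)) i = _
      rw [← h2 l]
    rw [e] at h3 ⊢
    exact sampleRank_comp_monotoneOn (hf i) h1 h3
  set D : Set (Fin n → EuclideanSpace ℝ (Fin p)) := {x | t < |2 * Real.sin (Real.pi / 6 *
      spearman (fun l => x l i) (fun l => x l j)) - Sig i j|}
  calc P {ω | t < |rankMatrix (fun l => X l ω) i j - Sig i j|} ≤ P (Y ⁻¹' D) := by
        refine measure_mono_ae ?_
        filter_upwards [hrank i, hrank j] with ω h1 h2 h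
        change t < |2 * Real.sin (Real.pi / 6 *
          spearman (fun l => X l ω i) (fun l => X l ω j)) - Sig i j| at h
        change t < |2 * Real.sin (Real.pi / 6 *
          spearman (fun l => Y ω l i) (fun l => Y ω l j)) - Sig i j|
        unfold spearman at h ⊢
        rwa [h1, h2] at h
    _ ≤ P.map Y D := Measure.le_map_apply hYm'.aemeasurable D
    _ ≤ _ := by
        rw [hYlaw, ENNReal.le_ofReal_iff_toReal_le (measure_ne_top _ _) (by positivity)]
        exact measureReal_rank_deviation_le hS hd i j hn ht

/-- Uniform version of the concentration bound, over all entries of the matrix. -/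
theorem measure_exists_rankMatrix_deviation_le {Ω : Type*} [MeasurableSpace Ω] {P : Measure Ω}
    [IsProbabilityMeasure P] {n p : ℕ} {Sig : Matrix (Fin p) (Fin p) ℝ}
    {μ : Measure (Fin p → ℝ)} {X : Fin n → Ω → Fin p → ℝ} (hS : Sig.PosSemidef)
    (hd : ∀ j, Sig j j = 1) (hμ : IsNonparanormal μ Sig) (hX : ∀ l, Measurable (X l))
    (hlaw : ∀ l, P.map (X l) = μ) (hind : iIndepFun X P) (hn : 2 ≤ n)
    {t : ℝ} (ht : 216 / n ≤ t) :
    P {ω | ∃ i j, t < |rankMatrix (fun l => X l ω) i j - Sig i j|} ≤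
      ENNReal.ofReal ((p : ℝ) ^ 2 * (2 * Real.exp (-(n * t ^ 2) / 41472))) := by
  have e : {ω | ∃ i j, t < |rankMatrix (fun l => X l ω) i j - Sig i j|} =
      ⋃ i, ⋃ j, {ω | t < |rankMatrix (fun l => X l ω) i j - Sig i j|} := by
    ext ω; simp
  rw [e]
  calc _ ≤ ∑ i, ∑ j, P {ω | t < |rankMatrix (fun l => X l ω) i j - Sig i j|} :=
        (measure_iUnion_fintype_le _ _).trans
          (Finset.sum_le_sum fun i _ => measure_iUnion_fintype_le _ _)
    _ ≤ ∑ _i : Fin p, ∑ _j : Fin p, ENNReal.ofReal (2 * Real.exp (-(n * t ^ 2) / 41472)) :=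
        Finset.sum_le_sum fun i _ => Finset.sum_le_sum fun j _ =>
          measure_rankMatrix_deviation_le hS hd hμ hX hlaw hind hn i j ht
    _ = _ := by
        rw [ENNReal.ofReal_mul (p := (p : ℝ) ^ 2) (by positivity),
          ENNReal.ofReal_pow (by positivity), ENNReal.ofReal_natCast]
        simp only [Finset.sum_const, Finset.card_univ, Fintype.card_fin, nsmul_eq_mul]
        ring

/-! ### Population regression coefficients and the Dantzig selector -/

theorem abs_sum_mul_le {ι : Type*} (s : Finset ι) {a h : ι → ℝ} {δ : ℝ}
    (ha : ∀ i ∈ s, |a i| ≤ δ) : |∑ i ∈ s, a i * h i| ≤ δ * ∑ i ∈ s, |h i| := by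
  rw [Finset.mul_sum]
  refine (Finset.abs_sum_le_sum_abs _ _).trans (Finset.sum_le_sum fun i hi => ?_)
  rw [abs_mul]
  exact mul_le_mul_of_nonneg_right (ha i hi) (abs_nonneg _)

theorem abs_sum_mul_le' {ι : Type*} (s : Finset ι) {a h : ι → ℝ} {V : ℝ}
    (hh : ∀ i ∈ s, |h i| ≤ V) : |∑ i ∈ s, a i * h i| ≤ (∑ i ∈ s, |a i|) * V := by
  have := abs_sum_mul_le s (a := h) (h := a) hh
  simp_rw [mul_comm (a _)]
  rwa [mul_comm]

theorem le_normL1 {ι κ : Type*} [Fintype ι] [Finite κ] (A : Matrix ι κ ℝ) (j : κ) :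
    ∑ i, |A i j| ≤ normL1 A :=
  le_ciSup (f := fun j => ∑ i, |A i j|) (Set.finite_range _).bddAbove j

theorem le_normLinf {ι κ : Type*} [Finite ι] [Fintype κ] (A : Matrix ι κ ℝ) (i : ι) :
    ∑ j, |A i j| ≤ normLinf A :=
  le_ciSup (f := fun i => ∑ j, |A i j|) (Set.finite_range _).bddAbove i

theorem minDiag_le {p : ℕ} (Sig : Matrix (Fin p) (Fin p) ℝ) (k : Fin p) :
    minDiag Sig ≤ Sig⁻¹ k k :=
  ciInf_le (Set.finite_range _).bddBelow k

/-- The population regression coefficients of the `k`-th variable on the others. -/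
noncomputable def betaStar {p : ℕ} (Sig : Matrix (Fin p) (Fin p) ℝ) (k : Fin p) : Off k → ℝ :=
  fun j => -(Sig⁻¹ j.1 k) / Sig⁻¹ k k

section Population

variable {p : ℕ} {Sig : Matrix (Fin p) (Fin p) ℝ}

theorem PosDef.inv_apply_comm (hS : Sig.PosDef) (i j : Fin p) : Sig⁻¹ i j = Sig⁻¹ j i := by
  simpa using hS.inv.1.apply j i

theorem PosDef.sum_mul_inv (hS : Sig.PosDef) (i j : Fin p) :
    ∑ l, Sig i l * Sig⁻¹ l j = if i = j then 1 else 0 := by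
  have h := Matrix.mul_nonsing_inv Sig ((Matrix.isUnit_iff_isUnit_det _).1 hS.isUnit)
  have := congrFun (congrFun h i) j
  rwa [Matrix.mul_apply, Matrix.one_apply] at this

theorem PosDef.sum_inv_mul (hS : Sig.PosDef) (i j : Fin p) :
    ∑ l, Sig⁻¹ i l * Sig l j = if i = j then 1 else 0 := by
  have h := Matrix.nonsing_inv_mul Sig ((Matrix.isUnit_iff_isUnit_det _).1 hS.isUnit)
  have := congrFun (congrFun h i) j
  rwa [Matrix.mul_apply, Matrix.one_apply] at this

/-- These are the rows other than `k` of the `k`-th column of `Sig * Sig⁻¹ = 1`, divided by `-Sig⁻¹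
k k`. -/
theorem offMat_mulVec_betaStar (hS : Sig.PosDef) (k : Fin p) :
    offMat Sig k *ᵥ betaStar Sig k = offVec Sig k := by
  have hk : Sig⁻¹ k k ≠ 0 := hS.inv.diag_pos.ne'
  ext i
  have h := PosDef.sum_mul_inv hS i.1 k
  rw [if_neg i.2, Fintype.sum_eq_add_sum_subtype_ne _ k] at h
  change ∑ j : Off k, Sig i.1 j.1 * (-(Sig⁻¹ j.1 k) / Sig⁻¹ k k) = Sig i.1 k
  have e : ∀ j : Off k, Sig i.1 j.1 * (-(Sig⁻¹ j.1 k) / Sig⁻¹ k k) =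
      Sig i.1 j.1 * Sig⁻¹ j.1 k * (-(Sig⁻¹ k k)⁻¹) := fun j => by ring
  simp_rw [e, ← Finset.sum_mul]
  rw [eq_neg_of_add_eq_zero_right h]
  field_simp

theorem one_add_sum_abs_betaStar_le {b M : ℝ} (hb : 0 < b) (hbS : b ≤ minDiag Sig)
    (hM : normL1 Sig⁻¹ ≤ M) (k : Fin p) : 1 + ∑ j, |betaStar Sig k j| ≤ M / b := by
  have hk : b ≤ Sig⁻¹ k k := hbS.trans (minDiag_le Sig k)
  have hk0 : 0 < Sig⁻¹ k k := hb.trans_le hk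
  have h := (le_normL1 Sig⁻¹ k).trans hM
  have hM0 : 0 ≤ M := (Finset.sum_nonneg fun _ _ => abs_nonneg _).trans h
  rw [Fintype.sum_eq_add_sum_subtype_ne _ k, abs_of_pos hk0] at h
  calc 1 + ∑ j, |betaStar Sig k j| = (Sig⁻¹ k k + ∑ j : Off k, |Sig⁻¹ j.1 k|) / Sig⁻¹ k k := by
        rw [add_div, div_self hk0.ne', Finset.sum_div]
        simp_rw [betaStar, abs_div, abs_neg, abs_of_pos hk0]
    _ ≤ M / Sig⁻¹ k k := div_le_div_of_nonneg_right h hk0.le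
    _ ≤ M / b := div_le_div_of_nonneg_left hM0 hb hk

/-- Stability of the regression problem without the `k`-th variable. -/
theorem abs_le_of_offMat_mulVec_le (hS : Sig.PosDef) {b M : ℝ} (hb : 0 < b)
    (hbS : b ≤ minDiag Sig) (hM : normL1 Sig⁻¹ ≤ M) {k : Fin p} {h : Off k → ℝ} {V : ℝ}
    (hV0 : 0 ≤ V) (hV : ∀ j, |(offMat Sig k *ᵥ h) j| ≤ V) (j : Off k) :
    |h j| ≤ M * (1 + M / b) * V := by
  have hk : b ≤ Sig⁻¹ k k := hbS.trans (minDiag_le Sig k)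
  have hk0 : 0 < Sig⁻¹ k k := hb.trans_le hk
  have hrow : ∀ i, ∑ l, |Sig⁻¹ i l| ≤ M := fun i => by
    simp_rw [PosDef.inv_apply_comm hS i]
    exact (le_normL1 Sig⁻¹ i).trans hM
  have hM0 : 0 ≤ M := (Finset.sum_nonneg fun _ _ => abs_nonneg _).trans (hrow k)
  -- Pad `h` by zero at `k` and apply the full matrix. The coordinate `y k` is not bounded by
  -- assumption, but the `k`-th entry of `Sig⁻¹ y` is the padding zero, which bounds `y k` through
  -- the other coordinates.
  set y : Fin p → ℝ := fun i => ∑ l : Off k, Sig i l.1 * h l with hy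
  have hyV : ∀ i : Off k, |y i.1| ≤ V := hV
  have hinv : ∀ i, ∑ m, Sig⁻¹ i m * y m = ∑ l : Off k, (if i = l.1 then 1 else 0) * h l := by
    intro i
    simp_rw [hy, Finset.mul_sum]
    rw [Finset.sum_comm]
    refine Finset.sum_congr rfl fun l _ => ?_
    rw [← PosDef.sum_inv_mul hS i l.1, Finset.sum_mul]
    exact Finset.sum_congr rfl fun m _ => by ring
  have hk1 : ∑ m, Sig⁻¹ k m * y m = 0 := by
    rw [hinv k]
    exact Finset.sum_eq_zero fun l _ => by rw [if_neg l.2.symm, zero_mul]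
  have hj1 : ∑ m, Sig⁻¹ j.1 m * y m = h j := by
    rw [hinv j.1]
    simp [← Subtype.ext_iff]
  have hyk : |y k| ≤ M / b * V := by
    rw [Fintype.sum_eq_add_sum_subtype_ne _ k] at hk1
    have h1 : |Sig⁻¹ k k * y k| ≤ M * V := by
      rw [eq_neg_of_add_eq_zero_left hk1, abs_neg]
      refine (abs_sum_mul_le' _ fun i _ => hyV i).trans (mul_le_mul_of_nonneg_right ?_ hV0)
      refine le_trans ?_ (hrow k)
      rw [Fintype.sum_eq_add_sum_subtype_ne _ k]
      exact le_add_of_nonneg_left (abs_nonneg _)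
    rw [abs_mul, abs_of_pos hk0] at h1
    have h2 : b * |y k| ≤ M * V := (mul_le_mul_of_nonneg_right hk (abs_nonneg _)).trans h1
    rw [div_mul_eq_mul_div, le_div_iff₀ hb]
    linarith
  have hall : ∀ i, |y i| ≤ (1 + M / b) * V := by
    intro i
    have : 0 ≤ M / b * V := by positivity
    by_cases hik : i = k
    · rw [hik]; linarith
    · have := hyV ⟨i, hik⟩
      linarith
  rw [← hj1, mul_assoc]
  exact (abs_sum_mul_le' _ fun i _ => hall i).trans
    (mul_le_mul_of_nonneg_right (hrow j.1) (by positivity))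

theorem mem_activeSet {k : Fin p} {j : Off k} : j ∈ activeSet Sig k ↔ Sig⁻¹ k j.1 ≠ 0 := by
  simp [activeSet]

theorem betaStar_eq_zero_iff (hS : Sig.PosDef) {k : Fin p} {j : Off k} :
    betaStar Sig k j = 0 ↔ j ∉ activeSet Sig k := by
  have hk : Sig⁻¹ k k ≠ 0 := hS.inv.diag_pos.ne'
  rw [mem_activeSet, not_not, betaStar, div_eq_zero_iff, neg_eq_zero,
    PosDef.inv_apply_comm hS j.1 k]
  simp [hk]

theorem posDef_sigSS (hS : Sig.PosDef) (k : Fin p) : (sigSS Sig k).PosDef :=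
  hS.submatrix (e := fun j : activeSet Sig k => j.1.1)
    (Subtype.val_injective.comp Subtype.val_injective)

/-- `betaStar` vanishes off the active set, so the population equations restrict to the active
block, which is invertible. -/
theorem betaActive_eq (hS : Sig.PosDef) (k : Fin p) (j : activeSet Sig k) :
    betaActive Sig k j = betaStar Sig k j.1 := by
  have hu : IsUnit (sigSS Sig k).det :=
    (Matrix.isUnit_iff_isUnit_det _).1 (posDef_sigSS hS k).isUnit
  have e : (fun j : activeSet Sig k => offVec Sig k j.1) =
      sigSS Sig k *ᵥ fun j : activeSet Sig k => betaStar Sig k j.1 := by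
    ext i
    rw [← congrFun (offMat_mulVec_betaStar hS k) i.1]
    change ∑ j : Off k, _ = ∑ j : activeSet Sig k, offMat Sig k i.1 j.1 * betaStar Sig k j.1
    rw [Finset.sum_coe_sort (activeSet Sig k) fun j => offMat Sig k i.1 j * betaStar Sig k j]
    refine (Finset.sum_subset (Finset.subset_univ _) fun j _ hj => ?_).symm
    rw [(betaStar_eq_zero_iff hS).2 hj, mul_zero]
  rw [betaActive, e, Matrix.mulVec_mulVec, Matrix.nonsing_inv_mul _ hu, Matrix.one_mulVec]

end Population

section Dantzig

variable {p : ℕ} {Sig R : Matrix (Fin p) (Fin p) ℝ}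

/-- The feasible points whose `ℓ₁` norm does not exceed that of `β₀` form a compact set. -/
theorem exists_isDantzig {k : Fin p} {lam : ℝ} {β₀ : Off k → ℝ}
    (h₀ : ∀ j, |(offMat R k *ᵥ β₀ - offVec R k) j| ≤ lam) : ∃ β, IsDantzig R k lam β := by
  set N : (Off k → ℝ) → ℝ := fun β => ∑ j, |β j| with hN
  have hNc : Continuous N := by fun_prop
  set K : Set (Off k → ℝ) :=
    {β | (∀ j, |(offMat R k *ᵥ β - offVec R k) j| ≤ lam) ∧ N β ≤ N β₀} with hK
  have hclosed : IsClosed K := by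
    have e : K = (⋂ j, {β | |(offMat R k *ᵥ β - offVec R k) j| ≤ lam}) ∩ {β | N β ≤ N β₀} := by
      ext β; simp [hK]
    rw [e]
    refine IsClosed.inter (isClosed_iInter fun j => isClosed_le ?_ continuous_const)
      (isClosed_le hNc continuous_const)
    simp only [Pi.sub_apply, Matrix.mulVec, dotProduct]
    fun_prop
  have hbdd : Bornology.IsBounded K := by
    refine (Metric.isBounded_iff_subset_closedBall 0).2 ⟨N β₀, fun β hβ => ?_⟩
    rw [mem_closedBall_zero_iff, pi_norm_le_iff_of_nonneg
      (Finset.sum_nonneg fun _ _ => abs_nonneg _)]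
    intro j
    exact (Finset.single_le_sum (f := fun j => |β j|) (fun _ _ => abs_nonneg _)
      (Finset.mem_univ j)).trans hβ.2
  obtain ⟨β, hβ, hmin⟩ := (Metric.isCompact_of_isClosed_isBounded hclosed hbdd).exists_isMinOn
    ⟨β₀, h₀, le_rfl⟩ hNc.continuousOn
  refine ⟨β, hβ.1, fun β' hβ' => ?_⟩
  by_cases h : N β' ≤ N β₀
  · exact hmin ⟨hβ', h⟩
  · exact hβ.2.trans (not_le.1 h).le

theorem abs_offMat_mulVec_sub_le {δ : ℝ} (hR : ∀ i j, |R i j - Sig i j| ≤ δ) {k : Fin p}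
    (h : Off k → ℝ) (j : Off k) :
    |(offMat R k *ᵥ h) j - (offMat Sig k *ᵥ h) j| ≤ δ * ∑ i, |h i| := by
  have e : (offMat R k *ᵥ h) j - (offMat Sig k *ᵥ h) j =
      ∑ i : Off k, (R j.1 i.1 - Sig j.1 i.1) * h i := by
    simp_rw [sub_mul, Finset.sum_sub_distrib]
    rfl
  rw [e]
  exact abs_sum_mul_le _ fun i _ => hR _ _

/-- The population residual is zero, so the residual comes from the errors in `R_(k)` and `r_(k)`
alone, at most `δ (‖β*‖₁ + 1)`. -/
theorem abs_residual_betaStar_le (hS : Sig.PosDef) {b M : ℝ} (hb : 0 < b)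
    (hbS : b ≤ minDiag Sig) (hM : normL1 Sig⁻¹ ≤ M) {δ : ℝ} (hδ : 0 ≤ δ)
    (hR : ∀ i j, |R i j - Sig i j| ≤ δ) (k : Fin p) (j : Off k) :
    |(offMat R k *ᵥ betaStar Sig k - offVec R k) j| ≤ δ * (M / b) := by
  have h1 := abs_offMat_mulVec_sub_le hR (betaStar Sig k) j
  have h2 : |offVec Sig k j - offVec R k j| ≤ δ := by rw [abs_sub_comm]; exact hR _ _
  rw [offMat_mulVec_betaStar hS] at h1
  calc |(offMat R k *ᵥ betaStar Sig k) j - offVec R k j| ≤ _ := abs_sub_le _ (offVec Sig k j) _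
    _ ≤ δ * (1 + ∑ i, |betaStar Sig k i|) := by linarith
    _ ≤ δ * (M / b) :=
      mul_le_mul_of_nonneg_left (one_add_sum_abs_betaStar_le hb hbS hM k) hδ

/-- Error bound for the Dantzig selector when the tuning parameter dominates the noise. -/
theorem dantzig_error_of_noise_le (hS : Sig.PosDef) {b M : ℝ} (hb : 0 < b)
    (hbS : b ≤ minDiag Sig) (hM : normL1 Sig⁻¹ ≤ M) {δ lam : ℝ} (hδ : 0 ≤ δ)
    (hR : ∀ i j, |R i j - Sig i j| ≤ δ) (hlam : δ * (M / b) ≤ lam) (k : Fin p) :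
    (∃ β, IsDantzig R k lam β) ∧ ∀ β, IsDantzig R k lam β → ∀ j,
      |β j - betaStar Sig k j| ≤ M * (1 + M / b) * (4 * lam) := by
  have hres := abs_residual_betaStar_le hS hb hbS hM hδ hR k
  have hfeas : ∀ j, |(offMat R k *ᵥ betaStar Sig k - offVec R k) j| ≤ lam :=
    fun j => (hres j).trans hlam
  have hβ1 := one_add_sum_abs_betaStar_le hb hbS hM k
  have hs0 : 0 ≤ ∑ j, |betaStar Sig k j| := Finset.sum_nonneg fun _ _ => abs_nonneg _
  have hlam0 : 0 ≤ lam := (mul_nonneg hδ (by linarith)).trans hlam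
  refine ⟨exists_isDantzig hfeas, fun β hβ => ?_⟩
  refine abs_le_of_offMat_mulVec_le hS hb hbS hM (h := β - betaStar Sig k) (by positivity)
    fun j => ?_
  have h1 := abs_offMat_mulVec_sub_le hR (β - betaStar Sig k) j
  have h2 : |(offMat R k *ᵥ (β - betaStar Sig k)) j| ≤ 2 * lam := by
    have e : (offMat R k *ᵥ (β - betaStar Sig k)) j = (offMat R k *ᵥ β - offVec R k) j -
        (offMat R k *ᵥ betaStar Sig k - offVec R k) j := by
      rw [Matrix.mulVec_sub]; simp only [Pi.sub_apply]; ring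
    rw [e]
    exact (abs_sub _ _).trans (by linarith [hβ.1 j, hfeas j])
  -- As `betaStar` is feasible, optimality gives `‖β‖₁ ≤ ‖β*‖₁`. This crude bound suffices, with no
  -- restricted eigenvalue condition.
  have h3 : ∑ i, |(β - betaStar Sig k) i| ≤ 2 * (M / b) := by
    calc ∑ i, |(β - betaStar Sig k) i| ≤ ∑ i, (|β i| + |betaStar Sig k i|) :=
          Finset.sum_le_sum fun i _ => abs_sub _ _
      _ ≤ 2 * (M / b) := by
          rw [Finset.sum_add_distrib]
          linarith [hβ.2 _ hfeas]
  have h4 : δ * ∑ i, |(β - betaStar Sig k) i| ≤ 2 * lam := by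
    calc _ ≤ δ * (2 * (M / b)) := mul_le_mul_of_nonneg_left h3 hδ
      _ ≤ 2 * lam := by linarith
  have h5 := abs_sub_abs_le_abs_sub ((offMat Sig k *ᵥ (β - betaStar Sig k)) j)
    ((offMat R k *ᵥ (β - betaStar Sig k)) j)
  rw [abs_sub_comm] at h5
  linarith

/-- Error bound for the Dantzig selector in small dimension. -/
theorem dantzig_error_of_dim_mul_le (hS : Sig.PosDef) {b M : ℝ} (hb : 0 < b)
    (hbS : b ≤ minDiag Sig) (hM : normL1 Sig⁻¹ ≤ M) {δ lam : ℝ} (hδ : 0 ≤ δ) (hlam : 0 ≤ lam)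
    (hR : ∀ i j, |R i j - Sig i j| ≤ δ) (hsmall : M * (1 + M / b) * (δ * p) ≤ 1 / 2)
    (k : Fin p) :
    (∃ β, IsDantzig R k lam β) ∧ ∀ β, IsDantzig R k lam β → ∀ j,
      |β j - betaStar Sig k j| ≤ 2 * (M * (1 + M / b) * (lam + δ * (M / b))) := by
  have hβ1 := one_add_sum_abs_betaStar_le hb hbS hM k
  have hMb : 0 ≤ M / b := by
    have : 0 ≤ ∑ j, |betaStar Sig k j| := Finset.sum_nonneg fun _ _ => abs_nonneg _
    linarith
  have hM0 : 0 ≤ M := by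
    have := mul_nonneg hMb hb.le
    rwa [div_mul_cancel₀ _ hb.ne'] at this
  -- Stability passes from `Sig` to `R`: the perturbation costs at most `δ p ‖h‖`, and by `hsmall`
  -- half of `‖h‖` absorbs it.
  have stab : ∀ (h : Off k → ℝ) (V : ℝ), 0 ≤ V → (∀ j, |(offMat R k *ᵥ h) j| ≤ V) →
      ‖h‖ ≤ 2 * (M * (1 + M / b) * V) := by
    intro h V hV0 hV
    have hl1 : ∑ i, |h i| ≤ p * ‖h‖ := by
      calc ∑ i, |h i| ≤ ∑ _i : Off k, ‖h‖ := Finset.sum_le_sum fun i _ => norm_le_pi_norm h i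
        _ = Fintype.card (Off k) * ‖h‖ := by simp
        _ ≤ p * ‖h‖ := by
          refine mul_le_mul_of_nonneg_right ?_ (norm_nonneg _)
          have := Fintype.card_subtype_le fun j : Fin p => j ≠ k
          rw [Fintype.card_fin] at this
          exact_mod_cast this
    have hb1 : ∀ j, |(offMat Sig k *ᵥ h) j| ≤ V + δ * p * ‖h‖ := by
      intro j
      have h1 := abs_offMat_mulVec_sub_le hR h j
      have h2 := mul_le_mul_of_nonneg_left hl1 hδ
      have h5 := abs_sub_abs_le_abs_sub ((offMat Sig k *ᵥ h) j) ((offMat R k *ᵥ h) j)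
      rw [abs_sub_comm] at h5
      linarith [hV j]
    have hb2 : ‖h‖ ≤ M * (1 + M / b) * (V + δ * p * ‖h‖) :=
      (pi_norm_le_iff_of_nonneg (by positivity)).2 fun j =>
        abs_le_of_offMat_mulVec_le hS hb hbS hM (by positivity) hb1 j
    have h6 := mul_le_mul_of_nonneg_right hsmall (norm_nonneg h)
    linarith
  have hinj : Function.Injective (offMat R k).mulVec := by
    intro x y hxy
    have hz : ∀ j, |(offMat R k *ᵥ (x - y)) j| ≤ 0 := fun j => by
      rw [Matrix.mulVec_sub]
      simp [show offMat R k *ᵥ x = offMat R k *ᵥ y from hxy]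
    have := stab (x - y) 0 le_rfl hz
    rw [mul_zero, mul_zero] at this
    exact sub_eq_zero.1 (norm_le_zero_iff.1 this)
  -- A point with zero residual is feasible for any nonnegative tuning parameter, however small
  -- compared with the noise.
  obtain ⟨β₀, hβ₀⟩ : ∃ β₀, offMat R k *ᵥ β₀ = offVec R k :=
    (Matrix.mulVec_surjective_iff_isUnit.2 (Matrix.mulVec_injective_iff_isUnit.1 hinj)) _
  refine ⟨exists_isDantzig (β₀ := β₀) fun j => by simpa [hβ₀] using hlam, fun β hβ j => ?_⟩
  refine (norm_le_pi_norm (β - betaStar Sig k) j).trans (stab _ _ (by positivity) fun j => ?_)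
  have e : (offMat R k *ᵥ (β - betaStar Sig k)) j = (offMat R k *ᵥ β - offVec R k) j -
      (offMat R k *ᵥ betaStar Sig k - offVec R k) j := by
    rw [Matrix.mulVec_sub]; simp only [Pi.sub_apply]; ring
  rw [e]
  exact (abs_sub _ _).trans (add_le_add (hβ.1 j)
    (abs_residual_betaStar_le hS hb hbS hM hδ hR k j))

end Dantzig

/-! ### Weighted Dantzig selectors -/

/-- `β` minimizes `‖w ∘ β‖_{ℓ₁}` subject to `|Q β - q| ≤ lam • w` entrywise. -/
def IsWeightedDantzig {ι : Type*} [Fintype ι] (Q : Matrix ι ι ℝ) (q : ι → ℝ) (lam : ℝ)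
    (w β : ι → ℝ) : Prop :=
  (∀ j, |(Q *ᵥ β - q) j| ≤ lam * w j) ∧
  ∀ β' : ι → ℝ, (∀ j, |(Q *ᵥ β' - q) j| ≤ lam * w j) →
    ∑ j, |w j * β j| ≤ ∑ j, |w j * β' j|

/-- Extension by zero of a vector indexed by `S`. -/
def extendZero {ι : Type*} [DecidableEq ι] (S : Finset ι) (u : S → ℝ) : ι → ℝ := fun j => if h : j ∈ S then u ⟨j, h⟩ else 0

theorem extendZero_of_mem {ι : Type*} [DecidableEq ι] {S : Finset ι} (u : S → ℝ) (j : S) : extendZero S u j = u j := by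
  simp [extendZero]

theorem extendZero_of_notMem {ι : Type*} [DecidableEq ι] {S : Finset ι} (u : S → ℝ) {j : ι} (hj : j ∉ S) :
    extendZero S u j = 0 := by
  simp [extendZero, hj]

theorem mulVec_eq_sum_of_support {ι : Type*} [Fintype ι] {S : Finset ι} {h : ι → ℝ} (hh : ∀ j ∉ S, h j = 0)
    (Q : Matrix ι ι ℝ) (i : ι) : (Q *ᵥ h) i = ∑ j : S, Q i j * h j := by
  rw [Finset.sum_coe_sort S fun j => Q i j * h j]
  exact (Finset.sum_subset (Finset.subset_univ _) fun j _ hj => by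
    rw [hh j hj, mul_zero]).symm

section WeightedDantzig

variable {ι : Type*} [Fintype ι]

/-- Optimality and complementary slackness from a dual certificate `z`. -/
theorem isWeightedDantzig_of_certificate {Q : Matrix ι ι ℝ} (hQ : Q.IsSymm) {q : ι → ℝ}
    {lam : ℝ} {w β z : ι → ℝ}
    (hprimal : ∀ j, |(Q *ᵥ β - q) j| ≤ lam * w j)
    (hdual : ∀ j, |(Q *ᵥ z) j| ≤ w j)
    (hβ : ∀ j, (Q *ᵥ z) j * β j = w j * |β j|)
    (hz : ∀ j, (Q *ᵥ β - q) j * z j = -(lam * w j * |z j|)) :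
    IsWeightedDantzig Q q lam w β ∧ ∀ β', IsWeightedDantzig Q q lam w β' →
      (∀ j, (Q *ᵥ z) j * β' j = w j * |β' j|) ∧
      ∀ j, (Q *ᵥ β' - q) j * z j = -(lam * w j * |z j|) := by
  have hw : ∀ j, 0 ≤ w j := fun j => (abs_nonneg _).trans (hdual j)
  have habs : ∀ (β' : ι → ℝ) j, |w j * β' j| = w j * |β' j| := fun β' j => by
    rw [abs_mul, abs_of_nonneg (hw j)]
  -- Symmetry of `Q` moves it from `z` to `β'`. Bounding both sides termwise is weak duality; for an
  -- optimal `β'` every termwise bound must be an equality.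
  have hswap : ∀ β' : ι → ℝ, ∑ j, (Q *ᵥ z) j * β' j =
      ∑ j, (Q *ᵥ β' - q) j * z j + ∑ j, q j * z j := by
    intro β'
    rw [← Finset.sum_add_distrib]
    have e : ∀ j, (Q *ᵥ β' - q) j * z j + q j * z j = (Q *ᵥ β') j * z j := fun j => by
      simp only [Pi.sub_apply]; ring
    simp_rw [e]
    change (Q *ᵥ z) ⬝ᵥ β' = (Q *ᵥ β') ⬝ᵥ z
    rw [dotProduct_comm, Matrix.dotProduct_mulVec, ← Matrix.mulVec_transpose, hQ.eq]
  have hle1 : ∀ (β' : ι → ℝ) j, (Q *ᵥ z) j * β' j ≤ w j * |β' j| := fun β' j => by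
    refine (le_abs_self _).trans ?_
    rw [abs_mul]
    exact mul_le_mul_of_nonneg_right (hdual j) (abs_nonneg _)
  have hle2 : ∀ β' : ι → ℝ, (∀ j, |(Q *ᵥ β' - q) j| ≤ lam * w j) → ∀ j,
      -(lam * w j * |z j|) ≤ (Q *ᵥ β' - q) j * z j := fun β' h' j => by
    refine le_trans (neg_le_neg ?_) (neg_abs_le _)
    rw [abs_mul]
    exact mul_le_mul_of_nonneg_right (h' j) (abs_nonneg _)
  have hval : ∑ j, w j * |β j| = ∑ j, -(lam * w j * |z j|) + ∑ j, q j * z j := by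
    rw [← Finset.sum_congr rfl fun j _ => hβ j, hswap, Finset.sum_congr rfl fun j _ => hz j]
  refine ⟨⟨hprimal, fun β' h' => ?_⟩, fun β' h' => ?_⟩
  · simp_rw [habs]
    rw [hval]
    calc _ ≤ ∑ j, (Q *ᵥ β' - q) j * z j + ∑ j, q j * z j :=
          add_le_add_left (Finset.sum_le_sum fun j _ => hle2 β' h' j) _
      _ = ∑ j, (Q *ᵥ z) j * β' j := (hswap β').symm
      _ ≤ _ := Finset.sum_le_sum fun j _ => hle1 β' j
  · have hopt := h'.2 β hprimal
    simp_rw [habs] at hopt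
    rw [hval] at hopt
    have h1 : ∑ j, (Q *ᵥ z) j * β' j ≤ ∑ j, w j * |β' j| :=
      Finset.sum_le_sum fun j _ => hle1 β' j
    have h2 : ∑ j, -(lam * w j * |z j|) ≤ ∑ j, (Q *ᵥ β' - q) j * z j :=
      Finset.sum_le_sum fun j _ => hle2 β' h'.1 j
    have h3 := hswap β'
    have e1 : ∑ j, (Q *ᵥ z) j * β' j = ∑ j, w j * |β' j| := by linarith
    have e2 : ∑ j, -(lam * w j * |z j|) = ∑ j, (Q *ᵥ β' - q) j * z j := by linarith
    exact ⟨fun j => (Finset.sum_eq_sum_iff_of_le fun j _ => hle1 β' j).1 e1 j (Finset.mem_univ j),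
      fun j => ((Finset.sum_eq_sum_iff_of_le fun j _ => hle2 β' h'.1 j).1 e2 j
        (Finset.mem_univ j)).symm⟩

variable [DecidableEq ι]

/-- `Sg` is well conditioned on `S` and `R` is entrywise close to `Sg`. -/
structure BlockApprox (Sg R : Matrix ι ι ℝ) (S : Finset ι) (G H δ : ℝ) : Prop where
  isUnit : IsUnit (block Sg S S).det
  inv_le : ∀ i, ∑ j, |(block Sg S S)⁻¹ i j| ≤ G
  cross_le : ∀ i, ∑ j, |(block Sg Sᶜ S * (block Sg S S)⁻¹) i j| ≤ H
  close : ∀ i j, |R i j - Sg i j| ≤ δ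
  small : 2 * G * (δ * S.card) ≤ 1
  G_pos : 0 < G
  H_pos : 0 < H
  δ_nonneg : 0 ≤ δ

namespace BlockApprox

variable {Sg R : Matrix ι ι ℝ} {S : Finset ι} {G H δ : ℝ}

theorem abs_mulVec_sub_le (hA : BlockApprox Sg R S G H δ) {h : ι → ℝ} (hh : ∀ j ∉ S, h j = 0) (i : ι) :
    |(Sg *ᵥ h) i - (R *ᵥ h) i| ≤ δ * S.card * ‖h‖ := by
  have e : (Sg *ᵥ h) i - (R *ᵥ h) i = -∑ j : S, (R i j - Sg i j) * h j := by
    rw [mulVec_eq_sum_of_support hh, mulVec_eq_sum_of_support hh, ← Finset.sum_sub_distrib,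
      ← Finset.sum_neg_distrib]
    exact Finset.sum_congr rfl fun j _ => by ring
  rw [e, abs_neg]
  refine (abs_sum_mul_le' Finset.univ (h := fun j : S => h j) fun j _ =>
    norm_le_pi_norm h j).trans
    (mul_le_mul_of_nonneg_right ?_ (norm_nonneg _))
  calc ∑ j : S, |R i j - Sg i j| ≤ ∑ _j : S, δ := Finset.sum_le_sum fun j _ => hA.close i j
    _ = δ * S.card := by simp [mul_comm]

theorem norm_le_of_target (hA : BlockApprox Sg R S G H δ) {h : ι → ℝ} (hh : ∀ j ∉ S, h j = 0) {V : ℝ} (hV0 : 0 ≤ V)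
    (hV : ∀ j ∈ S, |(Sg *ᵥ h) j| ≤ V) : ‖h‖ ≤ G * V := by
  have hG := hA.G_pos
  refine (pi_norm_le_iff_of_nonneg (by positivity)).2 fun i => ?_
  by_cases hi : i ∈ S
  · have e : (fun j : S => h j) = (block Sg S S)⁻¹ *ᵥ fun j : S => (Sg *ᵥ h) j := by
      have : (fun j : S => (Sg *ᵥ h) j) = block Sg S S *ᵥ fun j : S => h j := by
        ext j
        exact mulVec_eq_sum_of_support hh Sg j
      rw [this, Matrix.mulVec_mulVec, Matrix.nonsing_inv_mul _ hA.isUnit, Matrix.one_mulVec]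
    have := congrFun e ⟨i, hi⟩
    change h i = ∑ j, _ at this
    rw [this]
    exact (abs_sum_mul_le' Finset.univ (h := fun j : S => (Sg *ᵥ h) j) fun j _ => hV j j.2).trans
      (mul_le_mul_of_nonneg_right (hA.inv_le _) hV0)
  · rw [hh i hi, norm_zero]; positivity

/-- For `h` supported on `S`, the values of `Sg h` off `S` are the image under `Sg_{S^c S}
(Sg_{SS})⁻¹` of its values on `S`. -/
theorem abs_cross_le (hA : BlockApprox Sg R S G H δ) {h : ι → ℝ} (hh : ∀ j ∉ S, h j = 0) {V : ℝ} (hV0 : 0 ≤ V)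
    (hV : ∀ j ∈ S, |(Sg *ᵥ h) j| ≤ V) {i : ι} (hi : i ∉ S) : |(Sg *ᵥ h) i| ≤ H * V := by
  have e : (fun j : ((Sᶜ : Finset ι)) => (Sg *ᵥ h) j) =
      (block Sg Sᶜ S * (block Sg S S)⁻¹) *ᵥ fun j : S => (Sg *ᵥ h) j := by
    have : (fun j : S => (Sg *ᵥ h) j) = block Sg S S *ᵥ fun j : S => h j := by
      ext j
      exact mulVec_eq_sum_of_support hh Sg j
    rw [this, Matrix.mulVec_mulVec, Matrix.mul_assoc, Matrix.nonsing_inv_mul _ hA.isUnit, Matrix.mul_one]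
    ext j
    exact mulVec_eq_sum_of_support hh Sg j
  have := congrFun e ⟨i, Finset.mem_compl.2 hi⟩
  change (Sg *ᵥ h) i = ∑ j, _ at this
  rw [this]
  exact (abs_sum_mul_le' Finset.univ (h := fun j : S => (Sg *ᵥ h) j) fun j _ => hV j j.2).trans
    (mul_le_mul_of_nonneg_right (hA.cross_le _) hV0)

theorem abs_target_le (hA : BlockApprox Sg R S G H δ) {h : ι → ℝ} {V : ℝ} {i : ι} (hh : ∀ j ∉ S, h j = 0)
    (hV : |(R *ᵥ h) i| ≤ V) : |(Sg *ᵥ h) i| ≤ V + δ * S.card * ‖h‖ := by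
  have h1 := hA.abs_mulVec_sub_le hh i
  have h2 := abs_sub_abs_le_abs_sub ((Sg *ᵥ h) i) ((R *ᵥ h) i)
  linarith

/-- Stability of the estimated block. -/
theorem norm_le_two_mul (hA : BlockApprox Sg R S G H δ) {h : ι → ℝ} (hh : ∀ j ∉ S, h j = 0) {V : ℝ} (hV0 : 0 ≤ V)
    (hV : ∀ j ∈ S, |(R *ᵥ h) j| ≤ V) : ‖h‖ ≤ 2 * G * V := by
  have hδ := hA.δ_nonneg
  -- By `small`, the perturbation contributes at most `‖h‖ / 2` to the right-hand side and is
  -- absorbed.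
  have h1 := hA.norm_le_of_target hh (V := V + δ * S.card * ‖h‖) (by positivity)
    fun j hj => hA.abs_target_le hh (hV j hj)
  have h2 := mul_le_mul_of_nonneg_right hA.small (norm_nonneg h)
  linarith

/-- Entrywise, `R h` and `Sg h` differ by at most `V`. So `Sg h` is at most `2V` on `S`, hence `2HV`
off it, and going back to `R` costs another `V`. -/
theorem abs_cross_le_of_estimate (hA : BlockApprox Sg R S G H δ) {h : ι → ℝ} (hh : ∀ j ∉ S, h j = 0) {V : ℝ} (hV0 : 0 ≤ V)
    (hV : ∀ j ∈ S, |(R *ᵥ h) j| ≤ V) {i : ι} (hi : i ∉ S) :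
    |(R *ᵥ h) i| ≤ (2 * H + 1) * V := by
  have hδ := hA.δ_nonneg
  have hH := hA.H_pos
  have hn := hA.norm_le_two_mul hh hV0 hV
  have hs : δ * S.card * ‖h‖ ≤ V := by
    calc δ * S.card * ‖h‖ ≤ δ * S.card * (2 * G * V) :=
          mul_le_mul_of_nonneg_left hn (by positivity)
      _ = 2 * G * (δ * S.card) * V := by ring
      _ ≤ 1 * V := mul_le_mul_of_nonneg_right hA.small hV0
      _ = V := one_mul V
  have h1 := hA.abs_cross_le hh (V := 2 * V) (by positivity)
    (fun j hj => (hA.abs_target_le hh (hV j hj)).trans (by linarith)) hi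
  have h2 := hA.abs_mulVec_sub_le hh i
  have h3 := abs_sub_abs_le_abs_sub ((R *ᵥ h) i) ((Sg *ᵥ h) i)
  rw [abs_sub_comm] at h3
  linarith

theorem isUnit_det_estimate (hA : BlockApprox Sg R S G H δ) : IsUnit (block R S S).det := by
  rw [← Matrix.isUnit_iff_isUnit_det, ← Matrix.mulVec_injective_iff_isUnit]
  intro x y hxy
  have hsup : ∀ j ∉ S, extendZero S (x - y) j = 0 := fun j hj => extendZero_of_notMem _ hj
  have hz := hA.norm_le_two_mul (h := extendZero S (x - y)) hsup le_rfl (fun j hj => by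
    rw [mulVec_eq_sum_of_support hsup]
    simp_rw [extendZero_of_mem]
    have := congrFun (show block R S S *ᵥ x = block R S S *ᵥ y from hxy) ⟨j, hj⟩
    have h2 : (block R S S *ᵥ (x - y)) ⟨j, hj⟩ = 0 := by
      rw [Matrix.mulVec_sub, Pi.sub_apply, this, sub_self]
    change |(block R S S *ᵥ (x - y)) ⟨j, hj⟩| ≤ 0
    rw [h2, abs_zero])
  rw [mul_zero, norm_le_zero_iff] at hz
  ext j
  have := congrFun hz j
  rw [extendZero_of_mem, Pi.zero_apply, Pi.sub_apply] at this
  linarith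

/-- The vector supported on `S` which solves the estimated block system. -/
theorem mulVec_extendZero_inv (hA : BlockApprox Sg R S G H δ) (y : S → ℝ) (j : S) :
    (R *ᵥ extendZero S ((block R S S)⁻¹ *ᵥ y)) j = y j := by
  rw [mulVec_eq_sum_of_support fun j hj => extendZero_of_notMem _ hj]
  simp_rw [extendZero_of_mem]
  change (block R S S *ᵥ ((block R S S)⁻¹ *ᵥ y)) j = y j
  rw [Matrix.mulVec_mulVec, Matrix.mul_nonsing_inv _ hA.isUnit_det_estimate, Matrix.one_mulVec]

end BlockApprox

theorem real_sign_eq_of_abs_sub_lt {x y : ℝ} (h : |x - y| < |y|) : Real.sign x = Real.sign y := by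
  rcases lt_trichotomy y 0 with hy | hy | hy
  · rw [abs_of_neg hy] at h
    have := (abs_lt.1 h).2
    rw [Real.sign_of_neg hy, Real.sign_of_neg (by linarith)]
  · rw [hy, abs_zero] at h
    exact absurd h (not_lt.2 (abs_nonneg _))
  · rw [abs_of_pos hy] at h
    have := (abs_lt.1 h).1
    rw [Real.sign_of_pos hy, Real.sign_of_pos (by linarith)]

theorem real_sign_mul_self (x : ℝ) : Real.sign x * x = |x| := by
  rcases lt_trichotomy x 0 with h | h | h
  · rw [Real.sign_of_neg h, abs_of_neg h, neg_one_mul]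
  · simp [h]
  · rw [Real.sign_of_pos h, abs_of_pos h, one_mul]

theorem real_abs_sign_le_one (x : ℝ) : |Real.sign x| ≤ 1 := by
  obtain h | h | h := Real.sign_apply_eq x <;> simp [h]

/-- Sign recovery by a weighted Dantzig selector with small weights on the support `S` of the
target `βs` and large weights off it. -/
theorem weightedDantzig_recovery {Sg R : Matrix ι ι ℝ} {S : Finset ι} {G H δ : ℝ}
    (hA : BlockApprox Sg R S G H δ) (hR : R.IsSymm) {q w βs : ι → ℝ} {lam ρ ψ W Wc : ℝ}
    (hsupp : ∀ j ∉ S, βs j = 0) (hψ : ∀ j ∈ S, ψ ≤ |βs j|)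
    (hres : ∀ j, |(R *ᵥ βs - q) j| ≤ ρ) (hlam : 0 ≤ lam) (hρ : 0 ≤ ρ) (hW0 : 0 ≤ W)
    (hw : ∀ j, 0 < w j) (hW : ∀ j ∈ S, w j ≤ W) (hWc : ∀ j ∉ S, Wc ≤ w j)
    (h1 : 2 * G * (lam * W + ρ) < ψ) (h2 : (2 * H + 1) * W < Wc)
    (h3 : (2 * H + 1) * (lam * W + ρ) + ρ ≤ lam * Wc) :
    (∃ β, IsWeightedDantzig R q lam w β) ∧
    (∀ β, IsWeightedDantzig R q lam w β →
      (∀ j ∈ S, Real.sign (β j) = Real.sign (βs j)) ∧ ∀ j ∉ S, β j = 0) ∧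
    ((∀ j, ((block R S S)⁻¹ *ᵥ fun i : S => w i * Real.sign (βs i)) j ≠ 0) →
      ∀ β β', IsWeightedDantzig R q lam w β → IsWeightedDantzig R q lam w β' → β = β') := by
  set V : ℝ := lam * W + ρ with hV
  have hV0 : 0 ≤ V := by positivity
  -- The dual certificate uses the signs of the target, so it can be defined before the primal
  -- point. That the primal point shares these signs is checked afterwards, from `h1`.
  set u : S → ℝ := (block R S S)⁻¹ *ᵥ fun i : S => w i * Real.sign (βs i) with hu
  set z : ι → ℝ := extendZero S u with hz
  have hzS : ∀ j : S, z j = u j := fun j => extendZero_of_mem u j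
  have hz0 : ∀ j ∉ S, z j = 0 := fun j hj => extendZero_of_notMem u hj
  have hRz : ∀ j : S, (R *ᵥ z) j = w j * Real.sign (βs j) := hA.mulVec_extendZero_inv _
  -- The primal point makes constraint `j` tight on the side dictated by the sign of `z j`. Where `z
  -- j = 0`, `Real.sign` is zero and the residual vanishes, which is still feasible.
  set β₀ : ι → ℝ := extendZero S ((block R S S)⁻¹ *ᵥ fun i : S =>
    q i - lam * w i * Real.sign (z i)) with hβ₀
  have hβ₀0 : ∀ j ∉ S, β₀ j = 0 := fun j hj => extendZero_of_notMem _ hj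
  have hRβ₀ : ∀ j : S, (R *ᵥ β₀) j = q j - lam * w j * Real.sign (z j) :=
    hA.mulVec_extendZero_inv _
  have hRzS : ∀ j ∈ S, |(R *ᵥ z) j| ≤ w j := fun j hj => by
    rw [hRz ⟨j, hj⟩, abs_mul, abs_of_pos (hw j)]
    exact mul_le_of_le_one_right (hw j).le (real_abs_sign_le_one _)
  have hRzSc : ∀ j ∉ S, |(R *ᵥ z) j| < w j := fun j hj =>
    ((hA.abs_cross_le_of_estimate hz0 hW0 (fun i hi => (hRzS i hi).trans (hW i hi)) hj).trans_lt
      h2).trans_le (hWc j hj)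
  have hfeasS : ∀ j ∈ S, |(R *ᵥ β₀ - q) j| ≤ lam * w j := fun j hj => by
    rw [Pi.sub_apply, hRβ₀ ⟨j, hj⟩, show q j - lam * w j * Real.sign (z j) - q j =
      -(lam * w j * Real.sign (z j)) by ring, abs_neg, abs_mul,
      abs_of_nonneg (mul_nonneg hlam (hw j).le)]
    exact mul_le_of_le_one_right (mul_nonneg hlam (hw j).le) (real_abs_sign_le_one _)
  -- deviation from the target of any feasible vector supported on `S`
  have hdev : ∀ β : ι → ℝ, (∀ j ∈ S, |(R *ᵥ β - q) j| ≤ lam * w j) → ∀ j ∈ S,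
      |(R *ᵥ (β - βs)) j| ≤ V := by
    intro β hβ j hj
    have e : (R *ᵥ (β - βs)) j = (R *ᵥ β - q) j - (R *ᵥ βs - q) j := by
      rw [Matrix.mulVec_sub]; simp only [Pi.sub_apply]; ring
    rw [e]
    exact (abs_sub _ _).trans (add_le_add ((hβ j hj).trans
      (mul_le_mul_of_nonneg_left (hW j hj) hlam)) (hres j))
  have hsign : ∀ β : ι → ℝ, (∀ j ∈ S, |(R *ᵥ β - q) j| ≤ lam * w j) → (∀ j ∉ S, β j = 0) →
      ∀ j ∈ S, Real.sign (β j) = Real.sign (βs j) := by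
    intro β hβ hβ0 j hj
    refine real_sign_eq_of_abs_sub_lt (lt_of_le_of_lt ?_ (h1.trans_le (hψ j hj)))
    exact (norm_le_pi_norm (β - βs) j).trans (hA.norm_le_two_mul (h := β - βs)
      (fun i hi => by rw [Pi.sub_apply, hβ0 i hi, hsupp i hi, sub_zero]) hV0 (hdev β hβ))
  have hprimal : ∀ j, |(R *ᵥ β₀ - q) j| ≤ lam * w j := by
    intro j
    by_cases hj : j ∈ S
    · exact hfeasS j hj
    · have hc := hA.abs_cross_le_of_estimate (h := β₀ - βs)
        (fun i hi => by rw [Pi.sub_apply, hβ₀0 i hi, hsupp i hi, sub_zero]) hV0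
        (hdev β₀ hfeasS) hj
      have e : (R *ᵥ β₀ - q) j = (R *ᵥ (β₀ - βs)) j + (R *ᵥ βs - q) j := by
        rw [Matrix.mulVec_sub]; simp only [Pi.sub_apply]; ring
      rw [e]
      calc _ ≤ _ := abs_add_le _ _
        _ ≤ (2 * H + 1) * V + ρ := add_le_add hc (hres j)
        _ ≤ lam * Wc := h3
        _ ≤ lam * w j := mul_le_mul_of_nonneg_left (hWc j hj) hlam
  obtain ⟨hopt, hslack⟩ := isWeightedDantzig_of_certificate hR (β := β₀) (z := z) hprimal
    (fun j => if hj : j ∈ S then hRzS j hj else (hRzSc j hj).le)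
    (fun j => by
      by_cases hj : j ∈ S
      · rw [hRz ⟨j, hj⟩, ← hsign β₀ hfeasS hβ₀0 j hj, mul_assoc, real_sign_mul_self]
      · rw [hβ₀0 j hj]; simp)
    (fun j => by
      by_cases hj : j ∈ S
      · rw [Pi.sub_apply, hRβ₀ ⟨j, hj⟩, ← real_sign_mul_self (z j)]
        ring
      · rw [hz0 j hj]; simp)
  -- Dual feasibility is strict off `S` by `h2`, so complementary slackness excludes nonzero entries
  -- there.
  have hoff : ∀ β, IsWeightedDantzig R q lam w β → ∀ j ∉ S, β j = 0 := by
    intro β hβ j hj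
    by_contra hne
    have := (hslack β hβ).1 j
    have hlt : (R *ᵥ z) j * β j < w j * |β j| := by
      refine (le_abs_self _).trans_lt ?_
      rw [abs_mul]
      exact mul_lt_mul_of_pos_right (hRzSc j hj) (abs_pos.2 hne)
    exact hlt.ne this
  refine ⟨⟨β₀, hopt⟩, fun β hβ => ⟨hsign β (fun j _ => hβ.1 j) (hoff β hβ), hoff β hβ⟩,
    fun hnd β β' hβ hβ' => ?_⟩
  -- Where `z j ≠ 0`, complementary slackness fixes the residual at `j`. Thus all solutions satisfy
  -- one nonsingular linear system on `S`.
  have hzero : ∀ j ∈ S, |(R *ᵥ (β - β')) j| ≤ 0 := by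
    intro j hj
    have hzj : z j ≠ 0 := by rw [hzS ⟨j, hj⟩]; exact hnd ⟨j, hj⟩
    have := mul_right_cancel₀ hzj (((hslack β hβ).2 j).trans ((hslack β' hβ').2 j).symm)
    have e : (R *ᵥ (β - β')) j = (R *ᵥ β - q) j - (R *ᵥ β' - q) j := by
      rw [Matrix.mulVec_sub]; simp only [Pi.sub_apply]; ring
    rw [e, this, sub_self, abs_zero]
  have := hA.norm_le_two_mul (h := β - β')
    (fun j hj => by rw [Pi.sub_apply, hoff β hβ j hj, hoff β' hβ' j hj, sub_zero]) le_rfl hzero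
  rw [mul_zero, norm_le_zero_iff] at this
  exact sub_eq_zero.1 this

end WeightedDantzig

/-! ### Graph recovery -/

section Recovery

variable {p n : ℕ} {Sig R : Matrix (Fin p) (Fin p) ℝ}

theorem rankMatrix_isSymm (x : Fin n → Fin p → ℝ) : (rankMatrix x).IsSymm := by
  have h : ∀ u v : Fin n → ℝ, pearson u v = pearson v u := fun u v => by
    unfold pearson
    rw [mul_comm √_]
    simp_rw [mul_comm (u _ - _)]
  ext i j
  simp only [Matrix.transpose_apply, rankMatrix, Matrix.of_apply, spearman]
  rw [h]

theorem two_le_of_one_le_maxDegree (h : 1 ≤ maxDegree Sig) : 2 ≤ p := by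
  by_contra! hp
  have : maxDegree Sig = 0 := by
    rw [maxDegree, ← Nat.bot_eq_zero, Finset.sup_eq_bot_iff]
    intro k _
    rw [Nat.bot_eq_zero, Finset.card_eq_zero]
    ext j
    exact absurd (Fin.ext (by have := j.1.2; have := k.2; omega)) j.2
  omega

theorem blockApprox_offMat (hS : Sig.PosDef) {G H δ : ℝ} (hG0 : 0 < G) (hH0 : 0 < H)
    (hδ : 0 ≤ δ) {k : Fin p} (hG : gK Sig k ≤ G) (hH : hK Sig k ≤ H)
    (hR : ∀ i j, |R i j - Sig i j| ≤ δ) (hsmall : 2 * G * (δ * maxDegree Sig) ≤ 1) :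
    BlockApprox (offMat Sig k) (offMat R k) (activeSet Sig k) G H δ where
  isUnit := (Matrix.isUnit_iff_isUnit_det _).1 (posDef_sigSS hS k).isUnit
  inv_le i := (le_normLinf _ i).trans hG
  cross_le i := (le_normLinf _ i).trans hH
  close i j := hR i.1 j.1
  small := by
    refine le_trans ?_ hsmall
    have : (activeSet Sig k).card ≤ maxDegree Sig :=
      Finset.le_sup (f := fun k => (activeSet Sig k).card) (Finset.mem_univ k)
    have : ((activeSet Sig k).card : ℝ) ≤ maxDegree Sig := by exact_mod_cast this
    gcongr
  G_pos := hG0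
  H_pos := hH0
  δ_nonneg := hδ

theorem inNbhd_iff_of_support {β : ∀ k : Fin p, Off k → ℝ}
    (h : ∀ k j, β k j ≠ 0 ↔ j ∈ activeSet Sig k) (i j : Fin p) :
    InNbhd β i j ↔ i ≠ j ∧ Sig⁻¹ i j ≠ 0 := by
  constructor
  · rintro ⟨hij, hne⟩
    exact ⟨hij.symm, mem_activeSet.1 ((h i ⟨j, hij⟩).1 hne)⟩
  · rintro ⟨hij, hne⟩
    exact ⟨hij.symm, (h i ⟨j, hij.symm⟩).2 (mem_activeSet.2 hne)⟩

theorem unionGraph_eq_of_support {β : ∀ k : Fin p, Off k → ℝ}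
    (h : ∀ k j, β k j ≠ 0 ↔ j ∈ activeSet Sig k) : unionGraph β = trueGraph Sig := by
  ext i j
  change InNbhd β i j ∨ InNbhd β j i ↔ i ≠ j ∧ (Sig⁻¹ i j ≠ 0 ∨ Sig⁻¹ j i ≠ 0)
  rw [inNbhd_iff_of_support h, inNbhd_iff_of_support h, ne_comm (a := j)]
  tauto

theorem interGraph_eq_of_support (hS : Sig.PosDef) {β : ∀ k : Fin p, Off k → ℝ}
    (h : ∀ k j, β k j ≠ 0 ↔ j ∈ activeSet Sig k) : interGraph β = trueGraph Sig := by
  ext i j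
  change InNbhd β i j ∧ InNbhd β j i ↔ i ≠ j ∧ (Sig⁻¹ i j ≠ 0 ∨ Sig⁻¹ j i ≠ 0)
  rw [inNbhd_iff_of_support h, inNbhd_iff_of_support h, ne_comm (a := j),
    PosDef.inv_apply_comm hS j i]
  tauto

/-- Deterministic recovery: accurate initial estimates and an accurate correlation matrix. -/
theorem recovers_of_inequalities (hn : 0 < n) (hS : Sig.PosDef) (hRs : R.IsSymm)
    {b M ψ G H δ e : ℝ} (hb : 0 < b) (hM0 : 0 < M) (hψ0 : 0 < ψ) (hG0 : 0 < G) (hH0 : 0 < H)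
    (hbS : b ≤ minDiag Sig) (hM : normL1 Sig⁻¹ ≤ M)
    (hψ : ∀ k, (activeSet Sig k).Nonempty → ψ ≤ psi Sig k)
    (hG : ∀ k, gK Sig k ≤ G) (hH : ∀ k, hK Sig k ≤ H)
    (hδ : 0 ≤ δ) (hR : ∀ i j, |R i j - Sig i j| ≤ δ)
    {lamD lamAd : Fin p → ℝ} (hlam : ∀ k, 0 ≤ lamAd k)
    (hnd : ∀ k, (∃ β, IsDantzig R k (lamD k) β) ∧ ∀ β, IsDantzig R k (lamD k) β →
      ∀ j, |β j - betaStar Sig k j| ≤ e)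
    (he : e ≤ ψ / 2)
    (h0 : 2 * G * (δ * maxDegree Sig) ≤ 1)
    (h1 : ∀ k, 2 * G * (lamAd k * (2 / ψ) + δ * (M / b)) < ψ)
    (h2 : (2 * H + 1) * (2 / ψ) < (e + 1 / n)⁻¹)
    (h3 : ∀ k, (2 * H + 1) * (lamAd k * (2 / ψ) + δ * (M / b)) + δ * (M / b) ≤
      lamAd k * (e + 1 / n)⁻¹) :
    Recovers n Sig R lamD lamAd := by
  have hn' : (0 : ℝ) < 1 / n := by positivity
  refine ⟨fun k => (hnd k).1, fun βnd hβnd => ?_⟩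
  have herr : ∀ k j, |βnd k j - betaStar Sig k j| ≤ e := fun k => (hnd k).2 _ (hβnd k)
  have hβψ : ∀ k, ∀ j ∈ activeSet Sig k, ψ ≤ |betaStar Sig k j| := fun k j hj => by
    rw [← betaActive_eq hS k ⟨j, hj⟩]
    exact (hψ k ⟨j, hj⟩).trans
      (ciInf_le (f := fun j => |betaActive Sig k j|) (Set.finite_range _).bddBelow _)
  have hβ0 : ∀ k, ∀ j ∉ activeSet Sig k, betaStar Sig k j = 0 :=
    fun k j hj => (betaStar_eq_zero_iff hS).2 hj
  have key := fun k => weightedDantzig_recovery (q := offVec R k) (w := weights n (βnd k))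
    (βs := betaStar Sig k) (lam := lamAd k) (ρ := δ * (M / b)) (ψ := ψ) (W := 2 / ψ)
    (Wc := (e + 1 / n)⁻¹) (blockApprox_offMat hS hG0 hH0 hδ (hG k) (hH k) hR h0)
    (hRs.submatrix _) (hβ0 k) (hβψ k) (abs_residual_betaStar_le hS hb hbS hM hδ hR k) (hlam k)
    (by positivity) (by positivity) (fun j => by unfold weights; positivity)
    -- On the active set the initial estimate has modulus at least `ψ - e ≥ ψ/2`; off it, at most
    -- `e`.
    (fun j hj => by
      rw [← inv_div]
      refine inv_anti₀ (by positivity) ?_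
      have h4 := abs_sub_abs_le_abs_sub (betaStar Sig k j) (βnd k j)
      rw [abs_sub_comm] at h4
      linarith [hβψ k j hj, herr k j])
    (fun j hj => by
      refine inv_anti₀ (by positivity) ?_
      have h4 := herr k j
      rw [hβ0 k j hj, sub_zero] at h4
      linarith)
    (h1 k) h2 (h3 k)
  refine ⟨fun k => (key k).1, fun k hnd => (key k).2.2 ?_, fun βad hβad => ?_⟩
  · unfold Nondegenerate at hnd
    simp_rw [betaActive_eq hS] at hnd
    exact hnd
  · have hsgn : ∀ k, ∀ j ∈ activeSet Sig k,
        Real.sign (βad k j) = Real.sign (betaStar Sig k j) :=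
      fun k => ((key k).2.1 _ (hβad k)).1
    have hoff : ∀ k, ∀ j ∉ activeSet Sig k, βad k j = 0 :=
      fun k => ((key k).2.1 _ (hβad k)).2
    have hsup : ∀ k j, βad k j ≠ 0 ↔ j ∈ activeSet Sig k := fun k j => by
      constructor
      · intro hne
        by_contra hj
        exact hne (hoff k j hj)
      · intro hj hz
        have := hsgn k j hj
        rw [hz, Real.sign_zero] at this
        exact (betaStar_eq_zero_iff hS).1 (Real.sign_eq_zero_iff.1 this.symm) hj
    refine ⟨fun k j => ?_, hoff, hsup, unionGraph_eq_of_support hsup,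
      interGraph_eq_of_support hS hsup⟩
    rw [betaActive_eq hS]
    exact hsgn k j j.2

/-- Deterministic recovery in terms of the rate `L`. -/
theorem exists_recovers_of_rate {b M ψ G H T K : ℝ} (hb : 0 < b) (hM0 : 0 < M) (hψ0 : 0 < ψ)
    (hG0 : 0 < G) (hH0 : 0 < H) (hT : 0 < T) (hK0 : 0 < K) :
    ∃ ε > 0, ∀ {p n : ℕ} {Sig R : Matrix (Fin p) (Fin p) ℝ} {L : ℝ} {lamD lamAd : Fin p → ℝ},
      0 < n → Sig.PosDef → R.IsSymm → b ≤ minDiag Sig → normL1 Sig⁻¹ ≤ M →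
      (∀ k, (activeSet Sig k).Nonempty → ψ ≤ psi Sig k) →
      (∀ k, gK Sig k ≤ G) → (∀ k, hK Sig k ≤ H) → 1 ≤ maxDegree Sig →
      (∀ i j, |R i j - Sig i j| ≤ T * L) → 1 / (n : ℝ) ≤ L → (maxDegree Sig : ℝ) * L ≤ ε →
      (∀ k, L ≤ lamAd k) → (∀ k, lamAd k ≤ ε) →
      (∀ k, (∃ β, IsDantzig R k (lamD k) β) ∧ ∀ β, IsDantzig R k (lamD k) β →
        ∀ j, |β j - betaStar Sig k j| ≤ K * L) →
      Recovers n Sig R lamD lamAd := by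
  set m := M / b with hm
  have hm0 : 0 < m := by positivity
  set W := 2 / ψ with hW
  have hW0 : 0 < W := by positivity
  -- Each `Qi` is the constant of one inequality required by `recovers_of_inequalities`: block
  -- perturbation, weights on the active set, signs, strict dual feasibility, primal feasibility.
  -- With `ε` the inverse of their sum, each `Qi * ε` is below one.
  set Q1 := 2 * G * T with hQ1
  set Q2 := 2 * K / ψ with hQ2
  set Q3 := 2 * G * (W + T * m) / ψ with hQ3
  set Q4 := (2 * H + 1) * W * (K + 1) with hQ4
  set Q5 := ((2 * H + 1) * (W + T * m) + T * m) * (K + 1) with hQ5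
  have p1 : 0 < Q1 := by positivity
  have p2 : 0 < Q2 := by positivity
  have p3 : 0 < Q3 := by positivity
  have p4 : 0 < Q4 := by positivity
  have p5 : 0 < Q5 := by positivity
  set ε := (Q1 + Q2 + Q3 + Q4 + Q5)⁻¹ with hε
  have hε0 : 0 < ε := by positivity
  have hsum : (Q1 + Q2 + Q3 + Q4 + Q5) * ε = 1 := mul_inv_cancel₀ (by positivity)
  have q1 := mul_pos p1 hε0
  have q2 := mul_pos p2 hε0
  have q3 := mul_pos p3 hε0
  have q4 := mul_pos p4 hε0
  have q5 := mul_pos p5 hε0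
  refine ⟨ε, hε0, ?_⟩
  intro p n Sig R L lamD lamAd hn hS hRs hbS hM hψ hG hH hd hR hnL hdL hLad hadε hnd
  have hn' : (0 : ℝ) < 1 / n := by positivity
  have hL0 : 0 < L := hn'.trans_le hnL
  have hd' : (1 : ℝ) ≤ maxDegree Sig := by exact_mod_cast hd
  have hLε : L ≤ ε := (le_mul_of_one_le_left hL0.le hd').trans hdL
  have hinv : ((K + 1) * L)⁻¹ ≤ (K * L + 1 / n)⁻¹ :=
    inv_anti₀ (by positivity) (by linarith)
  have hsumV : ∀ k, lamAd k * W + T * L * m ≤ (W + T * m) * lamAd k := fun k => by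
    have := mul_le_mul_of_nonneg_left (hLad k) (by positivity : 0 ≤ T * m)
    linarith
  refine recovers_of_inequalities (δ := T * L) (e := K * L) hn hS hRs hb hM0 hψ0 hG0 hH0 hbS hM
    hψ hG hH (by positivity) hR (fun k => hL0.le.trans (hLad k)) hnd ?_ ?_
    (fun k => ?_) ?_ (fun k => ?_)
  · have h := mul_le_mul_of_nonneg_left hLε p2.le
    have : Q2 * L ≤ 1 := by linarith
    rw [hQ2, div_mul_eq_mul_div, div_le_one hψ0] at this
    linarith
  · have h := mul_le_mul_of_nonneg_left hdL p1.le
    calc 2 * G * (T * L * maxDegree Sig) = Q1 * (maxDegree Sig * L) := by rw [hQ1]; ring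
      _ ≤ 1 := by linarith
  · have h := mul_le_mul_of_nonneg_left (hadε k) p3.le
    have : Q3 * lamAd k < 1 := by linarith
    rw [hQ3, div_mul_eq_mul_div, div_lt_one hψ0] at this
    refine lt_of_le_of_lt ?_ this
    have := mul_le_mul_of_nonneg_left (hsumV k) (by positivity : 0 ≤ 2 * G)
    change 2 * G * (lamAd k * W + T * L * m) ≤ _
    linarith
  · refine lt_of_lt_of_le ?_ hinv
    rw [lt_inv_comm₀ (by positivity) (by positivity)]
    have h := mul_le_mul_of_nonneg_left hLε p4.le
    have : Q4 * L < 1 := by linarith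
    rw [← one_div, lt_div_iff₀ (by positivity)]
    calc (K + 1) * L * ((2 * H + 1) * W) = Q4 * L := by rw [hQ4]; ring
      _ < 1 := this
  · have hc0 : 0 ≤ lamAd k := hL0.le.trans (hLad k)
    refine le_trans ?_ (mul_le_mul_of_nonneg_left hinv hc0)
    rw [← div_eq_mul_inv, le_div_iff₀ (by positivity)]
    have h := mul_le_mul_of_nonneg_left hLε p5.le
    have h5 : Q5 * L ≤ 1 := by linarith
    have hT1 := mul_le_mul_of_nonneg_left (hLad k) (by positivity : 0 ≤ T * m)
    have hbd : (2 * H + 1) * (lamAd k * W + T * L * m) + T * L * m ≤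
        ((2 * H + 1) * (W + T * m) + T * m) * lamAd k := by
      have := mul_le_mul_of_nonneg_left (hsumV k) (by positivity : 0 ≤ 2 * H + 1)
      linarith
    calc _ ≤ ((2 * H + 1) * (W + T * m) + T * m) * lamAd k * ((K + 1) * L) :=
          mul_le_mul_of_nonneg_right hbd (by positivity)
      _ = lamAd k * (Q5 * L) := by rw [hQ5]; ring
      _ ≤ lamAd k := mul_le_of_le_one_right hc0 h5

end Recovery

/-! ### Rates and the asymptotic statement -/

/-- The deviation constant for which the concentration bound is `2 p ^ (-s)`. -/
noncomputable def deviationConst (s : ℝ) : ℝ := √(41472 * (2 + s))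

theorem deviationConst_mono {s s' : ℝ} (h : s ≤ s') : deviationConst s ≤ deviationConst s' :=
  Real.sqrt_le_sqrt (by linarith)

theorem le_deviationConst {s : ℝ} (h : 1 ≤ s) : 216 ≤ deviationConst s :=
  Real.le_sqrt_of_sq_le (by linarith)

/-- Holds because `n log p ≥ 2 log 2 > 1`. It places the rate above the bias threshold `216/n` and
bounds the `1/n` in the weights. -/
theorem one_div_le_rate {p n : ℕ} (hp : 2 ≤ p) (hn : 2 ≤ n) :
    1 / (n : ℝ) ≤ √(Real.log p / n) := by
  have hn' : (2 : ℝ) ≤ n := by exact_mod_cast hn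
  have hp' : (2 : ℝ) ≤ p := by exact_mod_cast hp
  have hlog : Real.log 2 ≤ Real.log p := Real.log_le_log (by norm_num) hp'
  have := Real.log_two_gt_d9
  refine Real.le_sqrt_of_sq_le ?_
  rw [div_pow, one_pow, div_le_div_iff₀ (by positivity) (by positivity)]
  nlinarith

theorem measure_exists_deviation_le_rate {Ω : Type*} [MeasurableSpace Ω] {P : Measure Ω}
    [IsProbabilityMeasure P] {n p : ℕ} {Sig : Matrix (Fin p) (Fin p) ℝ}
    {μ : Measure (Fin p → ℝ)} {X : Fin n → Ω → Fin p → ℝ} (hS : Sig.PosSemidef)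
    (hd : ∀ j, Sig j j = 1) (hμ : IsNonparanormal μ Sig) (hX : ∀ l, Measurable (X l))
    (hlaw : ∀ l, P.map (X l) = μ) (hind : iIndepFun X P) (hn : 2 ≤ n) (hp : 2 ≤ p)
    {s : ℝ} (hs : 1 ≤ s) :
    P {ω | ∃ i j, deviationConst s * √(Real.log p / n) <
        |rankMatrix (fun l => X l ω) i j - Sig i j|} ≤
      ENNReal.ofReal (2 * Real.exp (-(s * Real.log p))) := by
  have hn' : (2 : ℝ) ≤ n := by exact_mod_cast hn
  have hp' : (2 : ℝ) ≤ p := by exact_mod_cast hp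
  have hlog : 0 ≤ Real.log p := Real.log_nonneg (by linarith)
  have ht : 216 / (n : ℝ) ≤ deviationConst s * √(Real.log p / n) := by
    calc 216 / (n : ℝ) = 216 * (1 / n) := by ring
      _ ≤ _ := mul_le_mul (le_deviationConst hs) (one_div_le_rate hp hn) (by positivity)
        (by unfold deviationConst; positivity)
  refine (measure_exists_rankMatrix_deviation_le hS hd hμ hX hlaw hind hn ht).trans
    (ENNReal.ofReal_le_ofReal (le_of_eq ?_))
  have e1 : (n : ℝ) * (deviationConst s * √(Real.log p / n)) ^ 2 =
      41472 * (2 + s) * Real.log p := by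
    rw [mul_pow, deviationConst, Real.sq_sqrt (by linarith), Real.sq_sqrt (by positivity)]
    field_simp
  have e2 : (p : ℝ) ^ 2 = Real.exp (2 * Real.log p) := by
    rw [mul_comm, Real.exp_mul, Real.exp_log (by linarith)]
    norm_num
  rw [e1, e2, mul_left_comm, ← Real.exp_add]
  congr 2
  ring

theorem corollary3 :
    -- an absolute constant
    ∃ A : ℝ, 0 < A ∧
    -- the constants
    ∀ b B M ψ G H : ℝ, 0 < b → 0 < B → 0 < M → 0 < ψ → 0 < G → 0 < H →
    -- for each sample size `n`: a dimension, a correlation matrix, an i.i.d. nonparanormal sample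
    ∀ (p : ℕ → ℕ) (Sig : ∀ n, Matrix (Fin (p n)) (Fin (p n)) ℝ)
      (μ : ∀ n, Measure (Fin (p n) → ℝ))
      (Ω : ℕ → Type*) [∀ n, MeasurableSpace (Ω n)]
      (P : ∀ n, Measure (Ω n)) [∀ n, IsProbabilityMeasure (P n)]
      (X : ∀ n, Fin n → Ω n → Fin (p n) → ℝ)
      (lamD lamAd : ∀ n, Fin (p n) → ℝ),
    (∀ n, (Sig n).PosDef) → (∀ n j, Sig n j j = 1) →
    (∀ n, IsNonparanormal (μ n) (Sig n)) →
    (∀ n l, Measurable (X n l)) → (∀ n l, (P n).map (X n l) = μ n) →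
    (∀ n, iIndepFun (X n) (P n)) →
    -- the graph has an edge
    (∀ n, 1 ≤ maxDegree (Sig n)) →
    -- the quantities `b`, `B`, `M`, `ψ_k`, `G_k`, `H_k` are of constant order
    (∀ n, b ≤ minDiag (Sig n)) → (∀ n, maxEig (Sig n)⁻¹ ≤ B) → (∀ n, normL1 (Sig n)⁻¹ ≤ M) →
    (∀ n k, (activeSet (Sig n) k).Nonempty → ψ ≤ psi (Sig n) k) →
    (∀ n k, gK (Sig n) k ≤ G) → (∀ n k, hK (Sig n) k ≤ H) →
    -- `n ≫ d ^ 4 log p`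
    (fun n => (maxDegree (Sig n) : ℝ) ^ 4 * Real.log (p n)) =o[atTop] (fun n => (n : ℝ)) →
    -- `λ_min(Σ_SS) ≫ d ^ 2 (log p / n) ^ (1 / 2)`
    MuchLess (ι := fun n => {k // (activeSet (Sig n) k).Nonempty})
      (fun n _ => (maxDegree (Sig n) : ℝ) ^ 2 * √(Real.log (p n) / n))
      (fun n k => minEig (sigSS (Sig n) k.1)) →
    -- `λ_d` is of the exact order `(log p / n) ^ (1 / 2)`, with a large enough constant
    (∀ᶠ n in atTop, ∀ k, A * (M / b) * √(Real.log (p n) / n) ≤ lamD n k) →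
    (∃ C : ℝ, ∀ᶠ n in atTop, ∀ k, lamD n k ≤ C * √(Real.log (p n) / n)) →
    -- `1 / d ≫ λ_d`
    MuchLess lamD (fun n _ => 1 / (maxDegree (Sig n) : ℝ)) →
    -- `min {λ_min(Σ_SS) / d, 1 / d} ≫ λ_ad`
    MuchLess (ι := fun n => {k // (activeSet (Sig n) k).Nonempty})
      (fun n k => lamAd n k.1)
      (fun n k => 1 / (maxDegree (Sig n) : ℝ) * minEig (sigSS (Sig n) k.1)) →
    MuchLess lamAd (fun n _ => 1 / (maxDegree (Sig n) : ℝ)) →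
    -- `λ_ad ≫ d λ_d`
    MuchLess (fun n k => (maxDegree (Sig n) : ℝ) * lamD n k) lamAd →
    Tendsto
      (fun n => P n {ω | Recovers n (Sig n) (rankMatrix fun l => X n l ω) (lamD n) (lamAd n)})
      atTop (𝓝 1) := by
  refine ⟨deviationConst 1, by unfold deviationConst; positivity, ?_⟩
  intro b B M ψ G H hb _ hM0 hψ0 hG0 hH0 p Sig μ Ω _ P _ X lamD lamAd hS hdiag hμ hX hlaw hind
    hd hbS _ hM hψ hG hH _ _ hlow hupp _ _ hadd hdlam
  obtain ⟨C, hC⟩ := hupp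
  have hp : ∀ n, 2 ≤ p n := fun n => two_le_of_one_le_maxDegree (hd n)
  have hm0 : 0 < M / b := by positivity
  refine tendsto_order.2 ⟨fun a ha => ?_, fun a ha => Eventually.of_forall fun n =>
    prob_le_one.trans_lt ha⟩
  obtain ⟨η, hη0, hη⟩ : ∃ η : ℝ, 0 < η ∧ a + ENNReal.ofReal η < 1 := by
    obtain ⟨r, hr0, hr⟩ := ENNReal.lt_iff_exists_real_btwn.1 (tsub_pos_of_lt ha)
    refine ⟨r, ENNReal.ofReal_pos.1 hr.1, ?_⟩
    rw [add_comm]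
    exact lt_tsub_iff_right.1 hr.2
  -- the deviation level: large enough for dimensions in which the base level does not suffice
  set s : ℝ := max 1 (Real.log (2 / η) / Real.log 2) with hs
  have hs1 : 1 ≤ s := le_max_left _ _
  set T : ℝ := deviationConst s with hT
  have hT0 : 0 < T := lt_of_lt_of_le (by norm_num) (le_deviationConst hs1)
  have hA0 : 0 < deviationConst 1 := lt_of_lt_of_le (by norm_num) (le_deviationConst le_rfl)
  set c : ℝ := M * (1 + M / b) with hc
  have hc0 : 0 < c := by positivity
  -- Large enough for both Dantzig error bounds, the one with dominated noise and the one in bounded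
  -- dimension.
  set K : ℝ := 4 * c * (|C| + 1) + 2 * c * (T * (M / b)) with hK
  have hK0 : 0 < K := by positivity
  obtain ⟨ε, hε0, hrec⟩ := exists_recovers_of_rate (T := T) (K := K) hb hM0 hψ0 hG0 hH0 hT0 hK0
  set κ : ℝ := deviationConst 1 * (M / b) with hκ
  have hκ0 : 0 < κ := by positivity
  -- The second entry makes the perturbation of the whole matrix small when `p ≤ 2/η`.
  set ε' : ℝ := min ε (1 / 2 / (c * (T * (2 / η)))) with hε'
  have hε'0 : 0 < ε' := by positivity
  filter_upwards [hlow, hC, hadd ε' hε'0, hdlam κ hκ0, eventually_ge_atTop 2]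
    with n hlown hCn haddn hdlamn hn2
  have hn0 : 0 < n := by omega
  set L : ℝ := √(Real.log (p n) / n) with hL
  have hnL : 1 / (n : ℝ) ≤ L := one_div_le_rate (hp n) hn2
  have hL0 : 0 < L := lt_of_lt_of_le (by positivity) hnL
  -- From `κ L ≤ λ_d` and `d λ_d ≤ κ λ_ad` follows `d L ≤ λ_ad`, and `λ_ad ≤ ε'/d`; so both `d L`
  -- and `λ_ad` are small.
  have hd' : (1 : ℝ) ≤ maxDegree (Sig n) := by exact_mod_cast hd n
  have hlam0 : ∀ k, 0 ≤ lamD n k := fun k => le_trans (by positivity) (hlown k)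
  have hdLad : ∀ k, (maxDegree (Sig n) : ℝ) * L ≤ lamAd n k := fun k => by
    have h1 := hdlamn k
    rw [abs_of_nonneg (mul_nonneg (by linarith) (hlam0 k))] at h1
    have h2 := mul_le_mul_of_nonneg_left (hlown k) (by linarith : (0 : ℝ) ≤ maxDegree (Sig n))
    have h3 : κ * ((maxDegree (Sig n) : ℝ) * L) ≤ κ * lamAd n k := by linarith
    exact le_of_mul_le_mul_left h3 hκ0
  have hadε' : ∀ k, lamAd n k ≤ ε' := fun k => by
    refine (le_abs_self _).trans ((haddn k).trans (mul_le_of_le_one_right hε'0.le ?_))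
    exact (div_le_one (by linarith)).2 hd'
  have hdL : (maxDegree (Sig n) : ℝ) * L ≤ ε' := by
    have k₀ : Fin (p n) := ⟨0, by have := hp n; omega⟩
    exact (hdLad k₀).trans (hadε' k₀)
  have hLd : L ≤ maxDegree (Sig n) * L := le_mul_of_one_le_left hL0.le hd'
  have hCn' : ∀ k, lamD n k ≤ (|C| + 1) * L := fun k =>
    (hCn k).trans (mul_le_mul_of_nonneg_right (by linarith [le_abs_self C]) hL0.le)
  have hpn : (2 : ℝ) ≤ p n := by exact_mod_cast hp n
  -- it suffices to find a deviation level that is rarely exceeded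
  have main : ∀ s' : ℝ, 1 ≤ s' → s' ≤ s → 2 * Real.exp (-(s' * Real.log (p n))) ≤ η →
      (∀ R : Matrix (Fin (p n)) (Fin (p n)) ℝ,
        (∀ i j, |R i j - Sig n i j| ≤ deviationConst s' * L) →
        ∀ k, (∃ β, IsDantzig R k (lamD n k) β) ∧ ∀ β, IsDantzig R k (lamD n k) β →
          ∀ j, |β j - betaStar (Sig n) k j| ≤ K * L) →
      a < P n {ω | Recovers n (Sig n) (rankMatrix fun l => X n l ω) (lamD n) (lamAd n)} := by
    intro s' hs' hss' hη' hdantzig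
    set good := {ω | Recovers n (Sig n) (rankMatrix fun l => X n l ω) (lamD n) (lamAd n)}
    set bad := {ω | ∃ i j, deviationConst s' * L <
        |rankMatrix (fun l => X n l ω) i j - Sig n i j|}
    have hbad : P n bad ≤ ENNReal.ofReal η :=
      (measure_exists_deviation_le_rate (hS n).posSemidef (hdiag n) (hμ n) (hX n) (hlaw n)
        (hind n) hn2 (hp n) hs').trans (ENNReal.ofReal_le_ofReal hη')
    have hcover : Set.univ ⊆ good ∪ bad := by
      intro ω _
      by_cases hω : ω ∈ bad
      · exact Or.inr hω
      · have hclose : ∀ i j, |rankMatrix (fun l => X n l ω) i j - Sig n i j| ≤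
            deviationConst s' * L := by
          intro i j
          by_contra! h
          exact hω ⟨i, j, h⟩
        refine Or.inl (hrec hn0 (hS n) (rankMatrix_isSymm _) (hbS n) (hM n) (hψ n) (hG n) (hH n)
          (hd n) (fun i j => (hclose i j).trans
            (mul_le_mul_of_nonneg_right (deviationConst_mono hss') hL0.le))
          hnL (hdL.trans (min_le_left _ _)) (fun k => hLd.trans (hdLad k))
          (fun k => (hadε' k).trans (min_le_left _ _)) (hdantzig _ hclose))
    by_contra! hcon
    have : (1 : ENNReal) ≤ a + ENNReal.ofReal η := by
      calc (1 : ENNReal) = P n Set.univ := measure_univ.symm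
        _ ≤ P n (good ∪ bad) := measure_mono hcover
        _ ≤ P n good + P n bad := measure_union_le _ _
        _ ≤ _ := add_le_add hcon hbad
    exact absurd hη (not_lt.2 this)
  -- The left side is `2/p`. Either the base level already fails with probability at most `η`, or `p
  -- < 2/η` and the higher level `s` is used.
  by_cases hlarge : 2 * Real.exp (-(1 * Real.log (p n))) ≤ η
  · refine main 1 le_rfl hs1 hlarge fun R hR k => ?_
    obtain ⟨hex, herr⟩ := dantzig_error_of_noise_le (hS n) hb (hbS n) (hM n) (lam := lamD n k)
      (by positivity) hR (by have := hlown k; linarith) k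
    refine ⟨hex, fun β hβ j => (herr β hβ j).trans ?_⟩
    have h1 := mul_le_mul_of_nonneg_left (hCn' k) hc0.le
    have h2 : 0 ≤ 2 * c * (T * (M / b)) * L := by positivity
    rw [hK]
    linarith
  · have hpη : (p n : ℝ) ≤ 2 / η := by
      rw [one_mul, Real.exp_neg, Real.exp_log (by linarith), not_le] at hlarge
      rw [le_div_iff₀ hη0]
      have := mul_lt_mul_of_pos_left hlarge (by linarith : (0 : ℝ) < p n)
      rw [mul_left_comm, mul_inv_cancel₀ (by linarith)] at this
      linarith
    refine main s hs1 le_rfl ?_ fun R hR k => ?_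
    · have hl2 : 0 < Real.log 2 := Real.log_pos (by norm_num)
      have h1 : Real.log (2 / η) ≤ s * Real.log (p n) := by
        calc Real.log (2 / η) = Real.log (2 / η) / Real.log 2 * Real.log 2 := by
              field_simp
          _ ≤ s * Real.log (p n) := mul_le_mul (le_max_right _ _)
              (Real.log_le_log (by norm_num) hpn) hl2.le (by linarith)
      calc 2 * Real.exp (-(s * Real.log (p n))) ≤ 2 * Real.exp (-Real.log (2 / η)) := by
            gcongr
        _ = η := by
            rw [Real.exp_neg, Real.exp_log (by positivity)]
            field_simp
    · have hsmall : M * (1 + M / b) * (T * L * p n) ≤ 1 / 2 := by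
        have h1 : L ≤ 1 / 2 / (c * (T * (2 / η))) := (hLd.trans hdL).trans (min_le_right _ _)
        rw [le_div_iff₀ (by positivity)] at h1
        calc M * (1 + M / b) * (T * L * p n) ≤ c * (T * L * (2 / η)) := by
              rw [← hc]; gcongr
          _ = L * (c * (T * (2 / η))) := by ring
          _ ≤ 1 / 2 := h1
      obtain ⟨hex, herr⟩ := dantzig_error_of_dim_mul_le (hS n) hb (hbS n) (hM n)
        (by positivity) (hlam0 k) hR hsmall k
      refine ⟨hex, fun β hβ j => (herr β hβ j).trans ?_⟩
      have h1 := mul_le_mul_of_nonneg_left (hCn' k) hc0.le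
      have h2 : 0 ≤ c * ((|C| + 1) * L) := by positivity
      rw [hK, ← hc]
      linarith
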